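/- Let $k$ be an algebraically closed field and let $Q$ be a finite quiver with vertex set $Q_0\neq\emptyset$ and arrow set $Q_1$. For $s,t\in Q_0$ let $sQ_1t$ be the set of arrows with source $s$ and target $t$. Let $kQ$ be the path algebra, $J(Q)\subset kQ$ the two-sided ideal generated by the arrows, $B:=T_2Q:=kQ/J(Q)^2$, $n:=\dim_kB=|Q_0|+|Q_1|$, and $J(B)$ the Jacobson radical of $B$; let $skQ_1t\subset B$ be the $k$-span of $sQ_1t$. Let $\operatorname{Inn}^*(B)$ be the group of automorphisms $b\mapsto(1+x)b(1+x)^{-1}$ of $B$ with $x\in J(B)$. Let $\operatorname{msa}(Q)$ be the set of $(n-1)$-dimensional unital subalgebras of $B$, a closed subvariety (with its reduced structure) of the Grassmannian $\operatorname{Gr}_{n-1}(B)$; these are the maximal subalgebras of $B$. For $s\ne t$ in $Q_0$ put $$A(s+t):=k(s+t)\oplus\bigoplus_{w\in Q_0\setminus\{s,t\}}kw\oplus J(B),$$ and for $s,t\in Q_0$ with $sQ_1t\neq\emptyset$ and a subspace $U\subset skQ_1t$ of codimension $1$ put $$A(s,t,U):=kQ_0\oplus U\oplus\bigoplus_{(w,y)\neq(s,t)}wkQ_1y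 .$$ Then the irreducible components of $\operatorname{msa}(Q)$ are exactly the following sets: 1. for each two-element subset $\{s,t\}\subset Q_0$ with $sQ_1t\cup tQ_1s=\emptyset$, the singleton $\{A(s+t)\}$, of dimension $0$; 2. for each $(s,t)\in Q_0^2$ with $s\neq t$ and $sQ_1t\neq\emptyset$, the set $\{A(s+t)\}\cup\bigcup_{U}\operatorname{Inn}^*(B)\cdot A(s,t,U)$, where $U$ runs over the codimension-one subspaces of $skQ_1t$; it has dimension $|sQ_1t|$; 3. for each $s\in Q_0$ with $sQ_1s\neq\emptyset$, the set $\bigcup_{U}\operatorname{Inn}^*(B)\cdot A(s,s,U)$, where $U$ runs over the codimension-one subspaces of $skQ_1s$; it has dimension $|sQ_1s|-1$. Each component of dimension $d$ is isomorphic, as a variety, to the projective space $\mathbb P^d$. Moreover there is a closed embedding of $\operatorname{msa}(Q)$ into the projective space of lines in $k^{|Q_0|+|Q_1|-1}$ under which all the irreducible components become linear subspaces. The dimension of $\operatorname{msa}(Q)$ is the maximum of the dimensions listed above (and $\operatorname{msa}(Q)=\emptyset$, with dimension $-\infty$, if $Q$ is a single vertex without arrows). Finally, $\operatorname{msa}(Q)$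 is irreducible (in particular non-empty) if and only if $Q$ is, up to isomorphism, one of the following: an $m$-Kronecker quiver with $m\geq1$ (two distinct vertices $s,t$ and exactly $m$ arrows, all from $s$ to $t$); an $m$-loop quiver with $m\ge 1$ (one vertex and $m$ loops); or two isolated vertices without arrows. -/

import Mathlib

open Topology Filter

noncomputable section

/-! ## Spaces with functions -/

/-- A `k`-space with functions: a topological space `X` together with, for every point `x`,
the functions `X → k` that are regular near `x`.  Only the germ of the function at `x` matters
(`congr`), so that a regular function on an open set `U` is a function which is regular at every
point of `U`.  Classical varieties over an algebraically closed field are spaces of this kind. -/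
class SpaceWithFunctions (k X : Type*) [Field k] [TopologicalSpace X] where
  /-- `f` is regular in a neighbourhood of `x`. -/
  RegularAt : (X → k) → X → Prop
  congr : ∀ {f g : X → k} {x : X}, RegularAt f x → f =ᶠ[𝓝 x] g → RegularAt g x
  eventually : ∀ {f : X → k} {x : X}, RegularAt f x → ∀ᶠ y in 𝓝 x, RegularAt f y
  const : ∀ (c : k) (x : X), RegularAt (fun _ => c) x
  add : ∀ {f g : X → k} {x : X}, RegularAt f x → RegularAt g x → RegularAt (f + g) x
  mul : ∀ {f g : X → k} {x : X}, RegularAt f x → RegularAt g x → RegularAt (f * g) x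
  inv : ∀ {f : X → k} {x : X}, RegularAt f x → f x ≠ 0 →
    (∀ᶠ y in 𝓝 x, f y ≠ 0) ∧ RegularAt f⁻¹ x

open SpaceWithFunctions (RegularAt)

/-- A subset of a space with functions, with the induced topology; its regular functions are
locally restrictions of regular functions of the ambient space.  (For a locally closed subset of
a variety this is the induced reduced structure.) -/
instance Subtype.spaceWithFunctions (k : Type*) {X : Type*} [Field k] [TopologicalSpace X]
    [SpaceWithFunctions k X] (P : X → Prop) : SpaceWithFunctions k {x // P x} where
  RegularAt f x := ∃ g : X → k, RegularAt g x.1 ∧ f =ᶠ[𝓝 x] fun y => g y.1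
  congr := fun ⟨g, hg, h⟩ h' => ⟨g, hg, h'.symm.trans h⟩
  eventually := by
    rintro f x ⟨g, hg, h⟩
    have h1 : ∀ᶠ y : {x // P x} in 𝓝 x, RegularAt g y.1 :=
      continuous_subtype_val.continuousAt.eventually (SpaceWithFunctions.eventually hg)
    filter_upwards [h1, h.eventuallyEq_nhds] with y hy hy'
    exact ⟨g, hy, hy'⟩
  const c x := ⟨fun _ => c, SpaceWithFunctions.const c x.1, EventuallyEq.rfl⟩
  add := fun ⟨g, hg, h⟩ ⟨g', hg', h'⟩ => ⟨g + g', SpaceWithFunctions.add hg hg', h.add h'⟩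
  mul := fun ⟨g, hg, h⟩ ⟨g', hg', h'⟩ => ⟨g * g', SpaceWithFunctions.mul hg hg', h.mul h'⟩
  inv := by
    rintro f x ⟨g, hg, h⟩ hx
    have hgx : g x.1 ≠ 0 := by rwa [← h.eq_of_nhds]
    obtain ⟨h1, h2⟩ := SpaceWithFunctions.inv hg hgx
    refine ⟨?_, g⁻¹, h2, ?_⟩
    · have h3 : ∀ᶠ y : {x // P x} in 𝓝 x, g y.1 ≠ 0 :=
        continuous_subtype_val.continuousAt.eventually h1
      filter_upwards [h3, h] with y hy hy'
      rwa [hy']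
    · filter_upwards [h] with y hy
      simp [hy]

/-- Isomorphism of spaces with functions: a homeomorphism which identifies the regular
functions. -/
def SpaceWithFunctions.Isomorphic (k X Y : Type*) [Field k] [TopologicalSpace X]
    [SpaceWithFunctions k X] [TopologicalSpace Y] [SpaceWithFunctions k Y] : Prop :=
  ∃ φ : X ≃ₜ Y, ∀ (f : Y → k) (x : X), RegularAt (f ∘ φ) x ↔ RegularAt f (φ x)

/-- Closed embedding of spaces with functions: an isomorphism onto a closed subset, equipped
with its induced structure. -/
def SpaceWithFunctions.IsClosedEmbedding (k : Type*) {X Y : Type*} [Field k] [TopologicalSpace X]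
    [SpaceWithFunctions k X] [TopologicalSpace Y] [SpaceWithFunctions k Y] (ι : X → Y) : Prop :=
  Topology.IsClosedEmbedding ι ∧ ∀ (f : X → k) (x : X),
    RegularAt f x ↔ ∃ g : Y → k, RegularAt g (ι x) ∧ f =ᶠ[𝓝 x] g ∘ ι

/-! ## Affine spaces and Grassmannians -/

/-- A finite-dimensional `k`-vector space `W`, regarded as an affine space. -/
def AffSpace (k W : Type*) [Field k] [AddCommGroup W] [Module k W] : Type _ := W

/-- The algebra of polynomial functions on `W`: it is generated by the linear forms. -/
def polyFun (k W : Type*) [Field k] [AddCommGroup W] [Module k W] :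
    Subalgebra k (AffSpace k W → k) :=
  Algebra.adjoin k {f | ∃ φ : Module.Dual k W, f = fun w : W => φ w}

/-- The Zariski topology: the non-vanishing loci of polynomial functions are a basis of it. -/
instance AffSpace.topology (k W : Type*) [Field k] [AddCommGroup W] [Module k W] :
    TopologicalSpace (AffSpace k W) :=
  TopologicalSpace.generateFrom {U | ∃ p ∈ polyFun k W, U = {x | p x ≠ 0}}

theorem polyFun.eventually_ne {k W : Type*} [Field k] [AddCommGroup W] [Module k W]
    {p : AffSpace k W → k} (hp : p ∈ polyFun k W) {x : AffSpace k W} (hx : p x ≠ 0) :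
    ∀ᶠ y in 𝓝 x, p y ≠ 0 :=
  IsOpen.mem_nhds (TopologicalSpace.isOpen_generateFrom_of_mem ⟨p, hp, rfl⟩) hx

/-- Regular functions on (open subsets of) affine space are locally quotients of polynomial
functions. -/
instance AffSpace.spaceWithFunctions (k W : Type*) [Field k] [AddCommGroup W] [Module k W] :
    SpaceWithFunctions k (AffSpace k W) where
  RegularAt f x := ∃ p ∈ polyFun k W, ∃ q ∈ polyFun k W, q x ≠ 0 ∧ ∀ᶠ y in 𝓝 x, f y = p y / q y
  congr := by
    rintro f g x ⟨p, hp, q, hq, hx, h⟩ h'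
    refine ⟨p, hp, q, hq, hx, ?_⟩
    filter_upwards [h, h'] with y h1 h2
    rw [← h2, h1]
  eventually := by
    rintro f x ⟨p, hp, q, hq, hx, h⟩
    filter_upwards [polyFun.eventually_ne hq hx, eventually_eventually_nhds.2 h] with y h1 h2
    exact ⟨p, hp, q, hq, h1, h2⟩
  const c x := ⟨fun _ => c, (polyFun k W).algebraMap_mem c, 1, one_mem _, one_ne_zero,
    Eventually.of_forall fun y => by simp⟩
  add := by
    rintro f g x ⟨p, hp, q, hq, hx, h⟩ ⟨p', hp', q', hq', hx', h'⟩
    refine ⟨p * q' + q * p', add_mem (mul_mem hp hq') (mul_mem hq hp'), q * q', mul_mem hq hq',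
      mul_ne_zero hx hx', ?_⟩
    filter_upwards [h, h', polyFun.eventually_ne hq hx, polyFun.eventually_ne hq' hx']
      with y h1 h2 h3 h4
    simp only [Pi.add_apply, Pi.mul_apply, h1, h2]
    rw [div_add_div _ _ h3 h4]
  mul := by
    rintro f g x ⟨p, hp, q, hq, hx, h⟩ ⟨p', hp', q', hq', hx', h'⟩
    refine ⟨p * p', mul_mem hp hp', q * q', mul_mem hq hq', mul_ne_zero hx hx', ?_⟩
    filter_upwards [h, h'] with y h1 h2
    simp only [Pi.mul_apply, h1, h2]
    rw [div_mul_div_comm]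
  inv := by
    rintro f x ⟨p, hp, q, hq, hx, h⟩ hf
    have hpx : p x ≠ 0 := by
      intro h0
      exact hf (by rw [h.self_of_nhds, h0, zero_div])
    refine ⟨?_, q, hq, p, hp, hpx, ?_⟩
    · filter_upwards [h, polyFun.eventually_ne hq hx, polyFun.eventually_ne hp hpx]
        with y h1 h2 h3
      rw [h1]
      exact div_ne_zero h3 h2
    · filter_upwards [h] with y h1
      rw [Pi.inv_apply, h1, inv_div]

/-- The space of `m`-frames in `W`, i.e. of injective linear maps `k ^ m → W`: an open subset of
the affine space `W ^ m`. -/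
abbrev Frame (k : Type*) (m : ℕ) (W : Type*) [Field k] [AddCommGroup W] [Module k W] : Type _ :=
  {F : AffSpace k (Fin m → W) // LinearIndependent k (show Fin m → W from F)}

/-- The Grassmannian of `m`-dimensional subspaces of the finite-dimensional space `W`. -/
def Gr (k : Type*) (m : ℕ) (W : Type*) [Field k] [AddCommGroup W] [Module k W] : Type _ :=
  {A : Submodule k W // Module.finrank k A = m}

namespace Gr

variable {k : Type*} {m : ℕ} {W : Type*} [Field k] [AddCommGroup W] [Module k W]

/-- The subspace of `W` corresponding to a point of the Grassmannian. -/
def toSubmodule (A : Gr k m W) : Submodule k W := A.1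

/-- The map sending a frame to the subspace it spans. -/
def ofFrame (F : Frame k m W) : Gr k m W :=
  ⟨Submodule.span k (Set.range (show Fin m → W from F.1)), by
    simpa using finrank_span_eq_card F.2⟩

/-- The Grassmannian carries the quotient topology of the Zariski topology on frames. -/
instance topology : TopologicalSpace (Gr k m W) :=
  TopologicalSpace.coinduced ofFrame inferInstance

theorem continuous_ofFrame : Continuous (ofFrame : Frame k m W → Gr k m W) :=
  continuous_coinduced_rng

/-- The Grassmannian as a geometric quotient of the space of frames: a function on an open set is
regular if and only if its pullback to the frames is regular. -/
instance spaceWithFunctions : SpaceWithFunctions k (Gr k m W) where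
  RegularAt f A := ∀ᶠ A' in 𝓝 A, ∀ F : Frame k m W, ofFrame F = A' → RegularAt (f ∘ ofFrame) F
  congr := by
    intro f g A h h'
    filter_upwards [h, eventually_eventually_nhds.2 h'] with A' h1 h2 F hF
    subst hF
    exact SpaceWithFunctions.congr (h1 F rfl) (continuous_ofFrame.continuousAt.eventually h2)
  eventually := fun h => eventually_eventually_nhds.2 h
  const c A := Eventually.of_forall fun A' F _ => SpaceWithFunctions.const c F
  add := by
    intro f g A h h'
    filter_upwards [h, h'] with A' h1 h2 F hF
    exact SpaceWithFunctions.add (h1 F hF) (h2 F hF)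
  mul := by
    intro f g A h h'
    filter_upwards [h, h'] with A' h1 h2 F hF
    exact SpaceWithFunctions.mul (h1 F hF) (h2 F hF)
  inv := by
    intro f A h hA
    have key : ∀ᶠ A' in 𝓝 A, f A' ≠ 0 := by
      obtain ⟨U, hU, hUo, hAU⟩ := eventually_nhds_iff.1 h
      refine eventually_nhds_iff.2 ⟨U ∩ {A' | f A' ≠ 0}, fun A' hA' => hA'.2, ?_, hAU, hA⟩
      refine isOpen_coinduced.2 (isOpen_iff_eventually.2 fun F hF => ?_)
      have h1 : ∀ᶠ F' in 𝓝 F, ofFrame F' ∈ U :=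
        continuous_ofFrame.continuousAt.eventually (hUo.mem_nhds hF.1)
      have h2 := (SpaceWithFunctions.inv (hU _ hF.1 F rfl) hF.2).1
      filter_upwards [h1, h2] with F' h3 h4 using ⟨h3, h4⟩
    refine ⟨key, ?_⟩
    filter_upwards [h, key] with A' h1 h2 F hF
    exact (SpaceWithFunctions.inv (h1 F hF) (by rwa [Function.comp_apply, hF])).2

end Gr

/-- The projective space of lines through the origin of `W`. -/
abbrev ProjSpace (k W : Type*) [Field k] [AddCommGroup W] [Module k W] : Type _ := Gr k 1 W

/-- The linear subspace of the projective space of `W` given by a vector subspace `L` of `W`. -/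
def linearSubspace {k W : Type*} [Field k] [AddCommGroup W] [Module k W] (L : Submodule k W) :
    Set (ProjSpace k W) :=
  {x | x.toSubmodule ≤ L}

/-- The variety of `m`-dimensional (unital) subalgebras of `B`, as a subset of the
Grassmannian. -/
def AlgGr (k : Type*) (m : ℕ) (B : Type*) [Field k] [Ring B] [Algebra k B] : Set (Gr k m B) :=
  {A | ∃ S : Subalgebra k B, Subalgebra.toSubmodule S = A.toSubmodule}

/-! ## Path algebras and the algebra `T₂Q` -/

open Quiver

/-- The path algebra `kQ` of the quiver `Q` with vertex set `V`: the vector space with basis the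
paths of `Q`. -/
def PathAlgebra (k V : Type*) [Field k] [Quiver V] : Type _ := (Σ a b : V, Path a b) →₀ k

namespace PathAlgebra

variable {k V : Type*} [Field k] [Quiver V]

instance : AddCommGroup (PathAlgebra k V) :=
  inferInstanceAs (AddCommGroup ((Σ a b : V, Path a b) →₀ k))

instance : Module k (PathAlgebra k V) :=
  inferInstanceAs (Module k ((Σ a b : V, Path a b) →₀ k))

/-- The basis vector of a path. -/
def of (k : Type*) [Field k] (p : Σ a b : V, Path a b) : PathAlgebra k V := Finsupp.single p 1

open Classical in
/-- The product of two paths: first `p`, then `q` if `q` starts where `p` ends; otherwise `0`. -/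
def pathMul (k : Type*) [Field k] (p q : Σ a b : V, Path a b) : PathAlgebra k V :=
  if h : p.2.1 = q.1 then of k ⟨p.1, q.2.1, (p.2.2.cast rfl h).comp q.2.2⟩ else 0

/-- The bilinear extension of the product of paths. -/
def mulHom (k V : Type*) [Field k] [Quiver V] :
    PathAlgebra k V →ₗ[k] PathAlgebra k V →ₗ[k] PathAlgebra k V :=
  Finsupp.linearCombination k fun p => Finsupp.linearCombination k (pathMul k p)

instance : Mul (PathAlgebra k V) := ⟨fun x y => mulHom k V x y⟩

theorem mul_def (x y : PathAlgebra k V) : x * y = mulHom k V x y := rfl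

@[elab_as_elim]
theorem induction {P : PathAlgebra k V → Prop} (x : PathAlgebra k V) (h0 : P 0)
    (hadd : ∀ x y, P x → P y → P (x + y)) (hof : ∀ (c : k) p, P (c • of k p)) : P x := by
  refine Finsupp.induction_linear (motive := P) x h0 (fun f g => hadd f g) (fun p c => ?_)
  have : (Finsupp.single p c : (Σ a b : V, Path a b) →₀ k) = c • Finsupp.single p 1 := by simp
  rw [this]
  exact hof c p

@[simp] theorem of_mul_of (p q : Σ a b : V, Path a b) : of k p * of k q = pathMul k p q := by
  have h1 : mulHom k V (of k p) = Finsupp.linearCombination k (pathMul k p) :=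
    (Finsupp.linearCombination_single k 1 p).trans (one_smul k _)
  have h2 : Finsupp.linearCombination k (pathMul k p) (of k q) = pathMul k p q :=
    (Finsupp.linearCombination_single k 1 q).trans (one_smul k _)
  exact (congrArg (fun L : PathAlgebra k V →ₗ[k] PathAlgebra k V => L (of k q)) h1).trans h2

theorem zero_mul' (x : PathAlgebra k V) : 0 * x = 0 := by
  simp only [mul_def, map_zero, LinearMap.zero_apply]

theorem mul_zero' (x : PathAlgebra k V) : x * 0 = 0 := by
  simp only [mul_def, map_zero]

theorem pathMul_assoc (p q r : Σ a b : V, Path a b) :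
    pathMul k p q * of k r = of k p * pathMul k q r := by
  obtain ⟨a, b, p⟩ := p
  obtain ⟨c, d, q⟩ := q
  obtain ⟨e, f, r⟩ := r
  by_cases h1 : b = c
  · subst h1
    by_cases h2 : d = e
    · subst h2
      simp [pathMul, Path.comp_assoc]
    · simp [pathMul, h2, mul_zero']
  · by_cases h2 : d = e
    · subst h2
      simp [pathMul, h1, zero_mul']
    · simp [pathMul, h1, h2, zero_mul', mul_zero']

variable [Fintype V]

/-- The identity is the sum of the trivial paths. -/
instance : One (PathAlgebra k V) := ⟨∑ v : V, of k ⟨v, v, Path.nil⟩⟩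

theorem one_def : (1 : PathAlgebra k V) = ∑ v : V, of k ⟨v, v, Path.nil⟩ := rfl

instance : Ring (PathAlgebra k V) where
  __ := (inferInstance : AddCommGroup (PathAlgebra k V))
  left_distrib x y z := by simp only [mul_def, map_add]
  right_distrib x y z := by simp only [mul_def, map_add, LinearMap.add_apply]
  zero_mul x := by simp only [mul_def, map_zero, LinearMap.zero_apply]
  mul_zero x := by simp only [mul_def, map_zero]
  mul_assoc x y z := by
    induction x using induction with
    | h0 => simp only [mul_def, map_zero, LinearMap.zero_apply]
    | hadd x x' hx hx' =>
      simp only [mul_def, map_add, LinearMap.add_apply] at hx hx' ⊢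
      rw [hx, hx']
    | hof c p =>
    induction y using induction with
    | h0 => simp only [mul_def, map_zero, LinearMap.zero_apply]
    | hadd y y' hy hy' =>
      simp only [mul_def, map_add, LinearMap.add_apply] at hy hy' ⊢
      rw [hy, hy']
    | hof d q =>
    induction z using induction with
    | h0 => simp only [mul_def, map_zero]
    | hadd z z' hz hz' =>
      simp only [mul_def, map_add] at hz hz' ⊢
      rw [hz, hz']
    | hof e r =>
    have h := pathMul_assoc (k := k) p q r
    rw [← of_mul_of, ← of_mul_of] at h
    simp only [mul_def, map_smul, LinearMap.smul_apply] at h ⊢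
    rw [h]
  one_mul x := by
    induction x using induction with
    | h0 => simp only [mul_def, map_zero]
    | hadd x x' hx hx' =>
      simp only [mul_def, map_add] at hx hx' ⊢
      rw [hx, hx']
    | hof c p =>
    classical
    obtain ⟨a, b, p⟩ := p
    have : ∀ v : V, mulHom k V (of k ⟨v, v, Path.nil⟩) (of k ⟨a, b, p⟩) =
        if v = a then of k ⟨a, b, p⟩ else 0 := by
      intro v
      rw [← mul_def, of_mul_of]
      by_cases h : v = a
      · subst h
        simp [pathMul]
      · simp [pathMul, h]
    simp only [mul_def, map_smul, one_def, map_sum, LinearMap.sum_apply, this]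
    simp
  mul_one x := by
    induction x using induction with
    | h0 => simp only [mul_def, map_zero, LinearMap.zero_apply]
    | hadd x x' hx hx' =>
      simp only [mul_def, map_add, LinearMap.add_apply] at hx hx' ⊢
      rw [hx, hx']
    | hof c p =>
    classical
    obtain ⟨a, b, p⟩ := p
    have : ∀ v : V, mulHom k V (of k ⟨a, b, p⟩) (of k ⟨v, v, Path.nil⟩) =
        if b = v then of k ⟨a, b, p⟩ else 0 := by
      intro v
      rw [← mul_def, of_mul_of]
      by_cases h : b = v
      · subst h
        simp [pathMul]
      · simp [pathMul, h]
    simp only [mul_def, map_smul, one_def, map_sum, LinearMap.smul_apply, this]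
    simp

instance : Algebra k (PathAlgebra k V) :=
  Algebra.ofModule (fun c x y => by simp only [mul_def, map_smul, LinearMap.smul_apply])
    (fun c x y => by simp only [mul_def, map_smul])

/-- The idempotent of a vertex. -/
def vertex (k : Type*) [Field k] (v : V) : PathAlgebra k V := of k ⟨v, v, Path.nil⟩

/-- The element of an arrow. -/
def arrow (k : Type*) [Field k] {s t : V} (α : s ⟶ t) : PathAlgebra k V := of k ⟨s, t, α.toPath⟩

/-- The two-sided ideal `J(Q)` of `kQ` generated by the arrows. -/
def arrowIdeal (k V : Type*) [Field k] [Quiver V] [Fintype V] : TwoSidedIdeal (PathAlgebra k V) :=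
  TwoSidedIdeal.span {x | ∃ (s t : V) (α : s ⟶ t), x = arrow k α}

/-- The two-sided ideal `J(Q)²`. -/
def arrowIdealSq (k V : Type*) [Field k] [Quiver V] [Fintype V] :
    TwoSidedIdeal (PathAlgebra k V) :=
  TwoSidedIdeal.span {z | ∃ x ∈ arrowIdeal k V, ∃ y ∈ arrowIdeal k V, z = x * y}

end PathAlgebra

/-- The truncated quiver algebra `T₂Q = kQ / J(Q)²`. -/
abbrev T₂ (k V : Type*) [Field k] [Quiver V] [Fintype V] : Type _ :=
  (PathAlgebra.arrowIdealSq k V).ringCon.Quotient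

/-! ## Radical and unipotent inner automorphisms -/

/-- The Jacobson radical `J(B)` as a subspace of `B`. -/
def radical (k B : Type*) [Field k] [Ring B] [Algebra k B] : Submodule k B :=
  (Ring.jacobson B).restrictScalars k

/-- `Inn*(B)`, the set of inner automorphisms `b ↦ (1 + x) b (1 + x)⁻¹` with `x ∈ J(B)`. -/
def innStar (k B : Type*) [Field k] [Ring B] [Algebra k B] : Set (B ≃ₐ[k] B) :=
  {φ | ∃ x ∈ radical k B, ∃ u : Bˣ, (u : B) = 1 + x ∧ ∀ b : B, φ b = u * b * (u⁻¹ : Bˣ)}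

/-! ## Maximal subalgebras of `T₂Q` -/

namespace T₂

variable (k : Type*) {V : Type*} [Field k] [Quiver V] [Fintype V]

/-- The class of the trivial path at `v` in `T₂Q`. -/
def vertex (v : V) : T₂ k V := (PathAlgebra.vertex k v : PathAlgebra k V)

/-- The class of an arrow in `T₂Q`. -/
def arrow {s t : V} (α : s ⟶ t) : T₂ k V := (PathAlgebra.arrow k α : PathAlgebra k V)

/-- The span `s kQ₁ t` of the arrows from `s` to `t`. -/
def arrowSpan (s t : V) : Submodule k (T₂ k V) :=
  Submodule.span k (Set.range fun α : s ⟶ t => arrow k α)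

/-- The subspace `A(s + t)`: the sum of `k (s + t)`, of the lines `k w` for the vertices
`w ≠ s, t`, and of the radical. -/
def sepSub (s t : V) : Submodule k (T₂ k V) :=
  Submodule.span k {vertex k s + vertex k t} ⊔
    Submodule.span k {b | ∃ w : V, w ≠ s ∧ w ≠ t ∧ b = vertex k w} ⊔ radical k (T₂ k V)

/-- The subspace `A(s, t, U)`: the sum of `kQ₀`, of `U`, of the spaces `w kQ₁ y` for
`(w, y) ≠ (s, t)`, and of the square of the radical (which is zero). -/
def splitSub (s t : V) (U : Submodule k (T₂ k V)) : Submodule k (T₂ k V) :=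
  Submodule.span k (Set.range fun v : V => vertex k v) ⊔ U ⊔
    (⨆ (w : V) (y : V) (_ : (w, y) ≠ (s, t)), arrowSpan k w y) ⊔ radical k (T₂ k V) ^ 2

/-- The union over all hyperplanes `U` of `s kQ₁ t` of the `Inn*`-orbits of `A(s, t, U)`. -/
def splitFamily (s t : V) : Set (Submodule k (T₂ k V)) :=
  {A | ∃ U : Submodule k (T₂ k V), U ≤ arrowSpan k s t ∧
    Module.finrank k U + 1 = Module.finrank k (arrowSpan k s t) ∧
    ∃ φ ∈ innStar k (T₂ k V), A = (splitSub k s t U).map φ.toLinearMap}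

end T₂

/-- The variety `msa(Q)` of subalgebras of codimension one of `T₂Q`. -/
def msa (k V : Type*) [Field k] [Quiver V] [Fintype V] :
    Set (Gr k (Module.finrank k (T₂ k V) - 1) (T₂ k V)) :=
  AlgGr k (Module.finrank k (T₂ k V) - 1) (T₂ k V)

/-- The set of subspaces of `T₂Q` which belong to a subset of `msa(Q)`. -/
def msa.subspaces {k V : Type*} [Field k] [Quiver V] [Fintype V] (Z : Set (msa k V)) :
    Set (Submodule k (T₂ k V)) :=
  (fun A : msa k V => A.1.toSubmodule) '' Z

/-- The list of (candidates for) components of `msa(Q)`: `IsListed k V C d` says that `C` is on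
the list, with assigned dimension `d`. -/
inductive msa.IsListed (k V : Type*) [Field k] [Quiver V] [Fintype V] :
    Set (Submodule k (T₂ k V)) → ℕ → Prop
  | isolated (s t : V) (hne : s ≠ t) (hst : IsEmpty (s ⟶ t)) (hts : IsEmpty (t ⟶ s)) :
      msa.IsListed k V {T₂.sepSub k s t} 0
  | nonloop (s t : V) (hne : s ≠ t) (hst : Nonempty (s ⟶ t)) :
      msa.IsListed k V (T₂.splitFamily k s t ∪ {T₂.sepSub k s t}) (Nat.card (s ⟶ t))
  | loop (s : V) (hs : Nonempty (s ⟶ s)) :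
      msa.IsListed k V (T₂.splitFamily k s s) (Nat.card (s ⟶ s) - 1)

/-! ## Some quivers -/

/-- The quiver is (isomorphic to) the `m`-loop quiver: one vertex and `m` loops. -/
def IsLoopQuiver (V : Type*) [Quiver V] (m : ℕ) : Prop :=
  ∃ s : V, (∀ v : V, v = s) ∧ Nat.card (s ⟶ s) = m

/-- The quiver is (isomorphic to) the `m`-Kronecker quiver: two vertices `s ≠ t`, and `m` arrows,
all of them from `s` to `t`. -/
def IsKroneckerQuiver (V : Type*) [Quiver V] (m : ℕ) : Prop :=
  ∃ s t : V, s ≠ t ∧ (∀ v : V, v = s ∨ v = t) ∧ Nat.card (s ⟶ t) = m ∧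
    IsEmpty (s ⟶ s) ∧ IsEmpty (t ⟶ t) ∧ IsEmpty (t ⟶ s)

/-- The quiver consists of two isolated vertices, without arrows. -/
def IsTwoIsolatedVertices (V : Type*) [Quiver V] : Prop :=
  Nat.card V = 2 ∧ ∀ s t : V, IsEmpty (s ⟶ t)

end

/-! A hyperplane of `B = T₂Q` is the kernel of a nonzero linear form, unique up to a scalar, so the
Grassmannian of hyperplanes is, as a variety, the projective space of the dual of `B`
(`Gr.isMorphism_hyperplaneEquiv`, `Gr.isMorphism_hyperplaneEquiv_symm`). The question becomes which
forms `f` have a kernel that contains 1 and is closed under multiplication.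

Write χ_v for the coefficient of the vertex v, a character of `B`, and let L(s,t) be the span of χ_s
- χ_t and of the coefficients of the arrows from s to t (`pairForms`). A product in `B` has an arrow
coefficient only through vertex times arrow or arrow times vertex, so every f in L(s,t) is a twisted
derivation, f(xy) = χ_s(x) f(y) + f(x) χ_t(y), and kills 1; hence its kernel is a subalgebra.
Conversely, multiplying well-chosen elements of the kernel shows that a form defining a subalgebra
lies in some L(s,t) (`exists_mem_pairForms`). So msa(Q) is the union of the finitely many linear
subspaces P(L(s,t)), which are closed and, when nonempty, irreducible; its components are the
maximal ones.

The only proper inclusions between nonzero spaces L(s,t) come from L(s,t) ⊆ L(t,s) when there is no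
arrow from s to t. Since dim L(s,t) is |sQ₁t| + 1 for s ≠ t and |sQ₁s| for s = t, this gives the
list with its dimensions (`isListed_iff`). The subalgebras are identified by `mem_splitFamily_iff`:
the kernel of a(χ_s - χ_t) + ∑ c_α α* is A(s + t) if c = 0 and a ≠ 0, and is conjugate under Inn* to
the kernel with a = 0 if c ≠ 0.

All L(s,t) lie in the space of forms vanishing at 1, of dimension n - 1, which yields the embedding.
The topological dimension of projective space is found by sending irreducible closed sets to the
prime ideals of their cones. Finally, msa(Q) is irreducible exactly when one nonzero L(s,t) contains
all the others, a condition on the quiver that is read off directly. -/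

noncomputable section

open SpaceWithFunctions
open Quiver

/-! ## Morphisms of spaces with functions -/

namespace SpaceWithFunctions

variable {k : Type*} [Field k] {X Y Z : Type*}
  [TopologicalSpace X] [SpaceWithFunctions k X] [TopologicalSpace Y] [SpaceWithFunctions k Y]
  [TopologicalSpace Z] [SpaceWithFunctions k Z]

variable (k) in
/-- A morphism of spaces with functions: a continuous map which pulls back regular functions to
regular functions. -/
structure IsMorphism (φ : X → Y) : Prop where
  continuous : Continuous φ
  regularAt_comp : ∀ {f : Y → k} {x : X}, RegularAt f (φ x) → RegularAt (f ∘ φ) x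

theorem IsMorphism.id : IsMorphism k (fun x : X => x) := ⟨continuous_id, fun h => h⟩

theorem IsMorphism.comp {ψ : Y → Z} {φ : X → Y} (hψ : IsMorphism k ψ) (hφ : IsMorphism k φ) :
    IsMorphism k (fun x => ψ (φ x)) :=
  ⟨hψ.continuous.comp hφ.continuous, fun h => hφ.regularAt_comp (hψ.regularAt_comp h)⟩

theorem isMorphism_subtype_val (P : X → Prop) : IsMorphism k (Subtype.val : {x // P x} → X) :=
  ⟨continuous_subtype_val, fun {f _} h => ⟨f, h, EventuallyEq.rfl⟩⟩

theorem IsMorphism.codRestrict {φ : X → Y} (hφ : IsMorphism k φ) {P : Y → Prop}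
    (h : ∀ x, P (φ x)) : IsMorphism k (fun x => (⟨φ x, h x⟩ : {y // P y})) := by
  have hc : Continuous (fun x => (⟨φ x, h x⟩ : {y // P y})) := hφ.continuous.subtype_mk _
  refine ⟨hc, ?_⟩
  rintro f x ⟨g, hg, hfg⟩
  have h1 : ∀ᶠ y in 𝓝 x, f ⟨φ y, h y⟩ = g (φ y) := hc.continuousAt.eventually hfg
  exact SpaceWithFunctions.congr (hφ.regularAt_comp hg) (EventuallyEq.symm h1)

/-- For open `U` the neighbourhoods of `x` in `U` push forward to those in `X`, so equality of germs
on `U` is equality of germs on `X`. -/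
theorem regularAt_of_isOpen_of_comp_val {U : Set X} (hU : IsOpen U) {f : X → k} {x : U}
    (h : RegularAt (f ∘ Subtype.val : U → k) x) : RegularAt f x.1 := by
  obtain ⟨g, hg, hfg⟩ := h
  refine SpaceWithFunctions.congr hg ?_
  have h1 : ∀ᶠ y in map Subtype.val (𝓝 x), g y = f y := eventually_map.2 hfg.symm
  rwa [hU.isOpenEmbedding_subtypeVal.map_nhds_eq] at h1

/-- Needed where a map to a Grassmannian lifts to frames only locally, as in
`Gr.isMorphism_hyperplaneEquiv_symm`. -/
theorem isMorphism_of_locally {φ : X → Y}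
    (h : ∀ x, ∃ U : Set X, IsOpen U ∧ x ∈ U ∧ IsMorphism k (fun y : U => φ y.1)) :
    IsMorphism k φ := by
  constructor
  · refine continuous_iff_continuousAt.2 fun x => ?_
    obtain ⟨U, hU, hx, hφ⟩ := h x
    exact (continuousOn_iff_continuous_domRestrict.2 hφ.continuous).continuousAt (hU.mem_nhds hx)
  · intro f x hf
    obtain ⟨U, hU, hx, hφ⟩ := h x
    exact regularAt_of_isOpen_of_comp_val (x := ⟨x, hx⟩) hU (hφ.regularAt_comp hf)

theorem isomorphic_of_isMorphism (e : X ≃ Y) (h : IsMorphism k e) (h' : IsMorphism k e.symm) :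
    Isomorphic k X Y := by
  refine ⟨⟨e, h.continuous, h'.continuous⟩, fun f x => ⟨fun hf => ?_, h.regularAt_comp⟩⟩
  have h1 : RegularAt (f ∘ e) (e.symm (e x)) := by simpa using hf
  have h2 := h'.regularAt_comp h1
  have h3 : (f ∘ e) ∘ e.symm = f := by ext; simp
  rwa [h3] at h2

theorem Isomorphic.trans (h : Isomorphic k X Y) (h' : Isomorphic k Y Z) : Isomorphic k X Z := by
  obtain ⟨φ, hφ⟩ := h
  obtain ⟨ψ, hψ⟩ := h'
  exact ⟨φ.trans ψ, fun f x => (hφ (f ∘ ψ) x).trans (hψ f (φ x))⟩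

/-- A morphism with closed range which has an inverse morphism on its range is a closed
embedding. -/
theorem isClosedEmbedding_of_isMorphism {ι : X → Y} (hι : IsMorphism k ι)
    (hc : IsClosed (Set.range ι)) (ρ : Set.range ι → X) (hρ : IsMorphism k ρ)
    (h : ∀ x, ρ ⟨ι x, x, rfl⟩ = x) : IsClosedEmbedding k ι := by
  have hι' : IsMorphism k (fun x => (⟨ι x, x, rfl⟩ : Set.range ι)) :=
    hι.codRestrict fun x => ⟨x, rfl⟩
  let e : X ≃ₜ Set.range ι :=
    { toFun := fun x => ⟨ι x, x, rfl⟩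
      invFun := ρ
      left_inv := h
      right_inv := by
        rintro ⟨_, x, rfl⟩
        exact Subtype.ext (by simp [h])
      continuous_toFun := hι'.continuous
      continuous_invFun := hρ.continuous }
  refine ⟨hc.isClosedEmbedding_subtypeVal.comp e.isClosedEmbedding, fun f x => ⟨fun hf => ?_, ?_⟩⟩
  -- The pullback of `f` along `ρ` is regular on the range, and by definition of the induced
  -- structure it is locally the restriction of a regular function on `Y`.
  · have h1 : RegularAt f (ρ (e x)) := by rwa [show ρ (e x) = x from h x]
    obtain ⟨g, hg, hfg⟩ := hρ.regularAt_comp h1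
    refine ⟨g, hg, ?_⟩
    have h2 := e.continuous.continuousAt.eventually hfg
    filter_upwards [h2] with y hy
    rwa [Function.comp_apply, show ρ (e y) = y from h y] at hy
  · rintro ⟨g, hg, hfg⟩
    exact SpaceWithFunctions.congr (hι.regularAt_comp hg) hfg.symm

end SpaceWithFunctions

/-! ## Polynomial maps -/

section PolynomialMap

variable {k : Type*} [Field k] {W W' : Type*} [AddCommGroup W] [Module k W] [AddCommGroup W']
  [Module k W']

variable (k) in
/-- A map between vector spaces all of whose coordinates are polynomial functions. -/
def IsPolynomialMap (g : AffSpace k W → AffSpace k W') : Prop :=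
  ∀ φ : Module.Dual k W', (fun x => φ (g x)) ∈ polyFun k W

theorem polyFun.dual_mem (φ : Module.Dual k W) : (fun w : W => φ w) ∈ polyFun k W :=
  Algebra.subset_adjoin ⟨φ, rfl⟩

theorem polyFun.induction {P : (AffSpace k W → k) → Prop} {p : AffSpace k W → k}
    (hp : p ∈ polyFun k W) (dual : ∀ φ : Module.Dual k W, P fun w : W => φ w)
    (const : ∀ c : k, P fun _ => c) (add : ∀ p q, P p → P q → P (p + q))
    (mul : ∀ p q, P p → P q → P (p * q)) : P p := by
  induction hp using Algebra.adjoin_induction with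
  | mem f hf => obtain ⟨φ, rfl⟩ := hf; exact dual φ
  | algebraMap c => exact const c
  | add p q _ _ hp hq => exact add p q hp hq
  | mul p q _ _ hp hq => exact mul p q hp hq

theorem IsPolynomialMap.comp_mem {g : AffSpace k W → AffSpace k W'} (hg : IsPolynomialMap k g)
    {p : AffSpace k W' → k} (hp : p ∈ polyFun k W') : p ∘ g ∈ polyFun k W := by
  refine polyFun.induction (P := fun p => p ∘ g ∈ polyFun k W) hp hg ?_ ?_ ?_
  · exact fun c => (polyFun k W).algebraMap_mem c
  · exact fun p q hp hq => add_mem hp hq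
  · exact fun p q hp hq => mul_mem hp hq

theorem IsPolynomialMap.isMorphism {g : AffSpace k W → AffSpace k W'}
    (hg : IsPolynomialMap k g) : IsMorphism k g := by
  have hc : Continuous g := by
    refine continuous_generateFrom_iff.2 ?_
    rintro _ ⟨p, hp, rfl⟩
    exact TopologicalSpace.isOpen_generateFrom_of_mem ⟨p ∘ g, hg.comp_mem hp, rfl⟩
  refine ⟨hc, ?_⟩
  rintro f x ⟨p, hp, q, hq, hx, h⟩
  exact ⟨p ∘ g, hg.comp_mem hp, q ∘ g, hg.comp_mem hq, hx, hc.continuousAt.eventually h⟩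

variable (k) in
/-- A vector as a point of affine space. -/
def AffSpace.of (w : W) : AffSpace k W := w

/-- A point of affine space as a vector. -/
def AffSpace.vec (x : AffSpace k W) : W := x

@[simp] theorem AffSpace.vec_of (w : W) : (AffSpace.of k w).vec = w := rfl

theorem LinearMap.isMorphism_affSpace (g : W →ₗ[k] W') :
    IsMorphism k (fun x : AffSpace k W => AffSpace.of k (g x.vec)) :=
  IsPolynomialMap.isMorphism fun φ => polyFun.dual_mem (φ ∘ₗ g)

theorem AffSpace.isTopologicalBasis :
    TopologicalSpace.IsTopologicalBasis
      {U : Set (AffSpace k W) | ∃ p ∈ polyFun k W, U = {x | p x ≠ 0}} := by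
  refine ⟨?_, ?_, rfl⟩
  · rintro _ ⟨p, hp, rfl⟩ _ ⟨q, hq, rfl⟩ x ⟨hx, hx'⟩
    refine ⟨_, ⟨p * q, mul_mem hp hq, rfl⟩, mul_ne_zero hx hx', fun y hy => ?_⟩
    exact ⟨left_ne_zero_of_mul hy, right_ne_zero_of_mul hy⟩
  · refine Set.eq_univ_of_forall fun x => ?_
    exact ⟨_, ⟨1, one_mem _, rfl⟩, one_ne_zero⟩

/-- The restriction of a polynomial function to a line is a polynomial in the parameter. -/
theorem polyFun.exists_polynomial_line {p : AffSpace k W → k} (hp : p ∈ polyFun k W) (x y : W) :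
    ∃ P : Polynomial k, ∀ t : k, p (x + t • y : W) = P.eval t := by
  refine polyFun.induction
    (P := fun p => ∃ P : Polynomial k, ∀ t : k, p (x + t • y : W) = P.eval t) hp ?_ ?_ ?_ ?_
  · exact fun φ =>
      ⟨Polynomial.C (φ x) + Polynomial.X * Polynomial.C (φ y), fun t => by simp [mul_comm t]⟩
  · exact fun c => ⟨Polynomial.C c, fun t => by simp⟩
  · rintro p q ⟨P, hP⟩ ⟨Q, hQ⟩
    exact ⟨P + Q, fun t => by rw [Polynomial.eval_add, ← hP, ← hQ]; rfl⟩
  · rintro p q ⟨P, hP⟩ ⟨Q, hQ⟩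
    exact ⟨P * Q, fun t => by rw [Polynomial.eval_mul, ← hP, ← hQ]; rfl⟩

/-- Join a point of each of two basic open sets by a line. The defining functions restrict to
nonzero polynomials in the parameter (nonzero at 0 and at 1 respectively), and over an infinite
field their product has a non-root. -/
instance AffSpace.irreducibleSpace [Infinite k] : IrreducibleSpace (AffSpace k W) where
  isPreirreducible_univ := by
    rintro U V hU hV ⟨x, -, hx⟩ ⟨y, -, hy⟩
    obtain ⟨_, ⟨p, hp, rfl⟩, hpx, hpU⟩ := isTopologicalBasis.exists_subset_of_mem_open hx hU
    obtain ⟨_, ⟨q, hq, rfl⟩, hqy, hqV⟩ := isTopologicalBasis.exists_subset_of_mem_open hy hV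
    let x' : W := x
    let y' : W := y
    obtain ⟨P, hP⟩ := polyFun.exists_polynomial_line hp x' (y' - x')
    obtain ⟨Q, hQ⟩ := polyFun.exists_polynomial_line hq x' (y' - x')
    have hP0 : P ≠ 0 := by
      rintro rfl
      have h0 := hP 0
      rw [zero_smul, add_zero, Polynomial.eval_zero] at h0
      exact hpx h0
    have hQ0 : Q ≠ 0 := by
      rintro rfl
      have h1 := hQ 1
      rw [one_smul, add_sub_cancel, Polynomial.eval_zero] at h1
      exact hqy h1
    obtain ⟨t, ht⟩ := Polynomial.exists_eval_ne_zero_of_natDegree_lt_card (P * Q)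
      (mul_ne_zero hP0 hQ0) (lt_of_lt_of_le Cardinal.natCast_lt_aleph0 (Cardinal.aleph0_le_mk k))
    rw [Polynomial.eval_mul] at ht
    refine ⟨(x' + t • (y' - x') : W), trivial, hpU ?_, hqV ?_⟩
    · exact fun h => left_ne_zero_of_mul ht ((hP t).symm.trans h)
    · exact fun h => right_ne_zero_of_mul ht ((hQ t).symm.trans h)
  toNonempty := ⟨(0 : W)⟩

end PolynomialMap

/-! ## Morphisms between Grassmannians -/

namespace Gr

variable {k : Type*} {m : ℕ} {W : Type*} [Field k] [AddCommGroup W] [Module k W]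
  {Y : Type*} [TopologicalSpace Y] [SpaceWithFunctions k Y]

@[ext] theorem ext {A A' : Gr k m W} (h : A.toSubmodule = A'.toSubmodule) : A = A' :=
  Subtype.ext h

theorem isMorphism_ofFrame : IsMorphism k (ofFrame : Frame k m W → Gr k m W) :=
  ⟨continuous_ofFrame, fun {_ F} h => h.self_of_nhds F rfl⟩

/-- Morphisms on open subsets of the Grassmannian are detected on frames. -/
theorem isMorphism_of_isOpen {U : Set (Gr k m W)} (hU : IsOpen U) {Φ : U → Y}
    (h : IsMorphism k (fun F : {F : Frame k m W // ofFrame F ∈ U} => Φ ⟨ofFrame F.1, F.2⟩)) :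
    IsMorphism k Φ := by
  have hU' : IsOpen {F : Frame k m W | ofFrame F ∈ U} := hU.preimage continuous_ofFrame
  have hΦ : Continuous Φ := by
    refine continuous_def.2 fun O hO => ?_
    rw [hU.isOpenEmbedding_subtypeVal.isOpen_iff_image_isOpen]
    refine isOpen_coinduced.2 ?_
    convert hU'.isOpenEmbedding_subtypeVal.isOpenMap _ (hO.preimage h.continuous) using 1
    ext F
    simp
  refine ⟨hΦ, ?_⟩
  · intro f x hf
    classical
    -- Regularity on a subset asks for a function on the whole Grassmannian. As `U` is open and only
    -- germs matter, extension by zero will do.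
    let g : Gr k m W → k := fun A => if h : A ∈ U then f (Φ ⟨A, h⟩) else 0
    have hg : ∀ y : U, f (Φ y) = g y.1 := fun y => by simp [g]
    refine ⟨g, ?_, Eventually.of_forall hg⟩
    have h1 : ∀ᶠ y in 𝓝 x, ∃ hy : y.1 ∈ U, RegularAt f (Φ ⟨y.1, hy⟩) := by
      filter_upwards [hΦ.continuousAt.eventually (SpaceWithFunctions.eventually hf)] with y hy
      exact ⟨y.2, hy⟩
    have h2 : ∀ᶠ A in map Subtype.val (𝓝 x), ∃ hA : A ∈ U, RegularAt f (Φ ⟨A, hA⟩) :=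
      eventually_map.2 h1
    rw [hU.isOpenEmbedding_subtypeVal.map_nhds_eq] at h2
    refine h2.mono ?_
    rintro _ ⟨hA, hfA⟩ F rfl
    have h3 := h.regularAt_comp (x := ⟨F, hA⟩) hfA
    refine regularAt_of_isOpen_of_comp_val (U := {F | ofFrame F ∈ U}) (x := ⟨F, hA⟩) hU' ?_
    refine SpaceWithFunctions.congr h3 (Eventually.of_forall fun F' => ?_)
    exact hg ⟨ofFrame F'.1, F'.2⟩

theorem isMorphism_of_frame {Φ : Gr k m W → Y}
    (h : IsMorphism k (fun F : Frame k m W => Φ (ofFrame F))) : IsMorphism k Φ := by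
  have h1 : IsMorphism k (fun A : (Set.univ : Set (Gr k m W)) => Φ A.1) :=
    isMorphism_of_isOpen isOpen_univ (h.comp (isMorphism_subtype_val _))
  exact h1.comp (IsMorphism.id.codRestrict fun A => Set.mem_univ A)

end Gr

/-! ## Projective spaces -/

/-- `L` is the common zero locus of the linear forms pulled back from `W ⧸ L`, because linear forms
separate the points of a vector space. -/
theorem AffSpace.isClosed_submodule {k W : Type*} [Field k] [AddCommGroup W] [Module k W]
    (L : Submodule k W) : IsClosed {x : AffSpace k W | x.vec ∈ L} := by
  have : {x : AffSpace k W | x.vec ∈ L} =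
      ⋂ φ : Module.Dual k (W ⧸ L), {x : AffSpace k W | φ (L.mkQ x.vec) ≠ 0}ᶜ := by
    ext x
    have h := Module.forall_dual_apply_eq_zero_iff k (L.mkQ x.vec)
    simp only [Set.mem_ofPred_eq, Set.mem_iInter, Set.mem_compl_iff, not_not]
    exact ((Submodule.Quotient.mk_eq_zero L).symm.trans h.symm)
  rw [this]
  refine isClosed_iInter fun φ => IsOpen.isClosed_compl ?_
  exact TopologicalSpace.isOpen_generateFrom_of_mem ⟨_, polyFun.dual_mem (φ ∘ₗ L.mkQ), rfl⟩

namespace Gr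

variable {k : Type*} {m : ℕ} {W : Type*} [Field k] [AddCommGroup W] [Module k W]

theorem toSubmodule_ofFrame (F : Frame k m W) :
    (ofFrame F).toSubmodule = Submodule.span k (Set.range (show Fin m → W from F.1)) := rfl

theorem finrank_toSubmodule (A : Gr k m W) : Module.finrank k A.toSubmodule = m := A.2

end Gr

/-! ### Frames of one vector: nonzero vectors as representatives of points of projective space -/

namespace Frame

variable {k : Type*} {W : Type*} [Field k] [AddCommGroup W] [Module k W]

/-- The vector of a frame consisting of one vector. -/
def vec (F : Frame k 1 W) : W := F.1.vec 0

theorem vec_ne_zero (F : Frame k 1 W) : F.vec ≠ 0 := F.2.ne_zero 0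

/-- The frame consisting of one nonzero vector. -/
def ofVec (w : W) (hw : w ≠ 0) : Frame k 1 W :=
  ⟨AffSpace.of k fun _ : Fin 1 => w, LinearIndependent.of_subsingleton 0 hw⟩

@[simp] theorem vec_ofVec (w : W) (hw : w ≠ 0) : (ofVec w hw : Frame k 1 W).vec = w := rfl

theorem toSubmodule_ofFrame (F : Frame k 1 W) :
    (Gr.ofFrame F).toSubmodule = Submodule.span k {F.vec} := by
  rw [Gr.toSubmodule_ofFrame, Set.range_unique]
  rfl

theorem vec_injective : Function.Injective (vec : Frame k 1 W → W) := by
  intro F F' h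
  refine Subtype.ext (funext fun i => ?_)
  rw [Subsingleton.elim i 0]
  exact h

theorem isMorphism_vec : IsMorphism k (fun F : Frame k 1 W => AffSpace.of k F.vec) :=
  (LinearMap.proj (R := k) (φ := fun _ : Fin 1 => W) 0).isMorphism_affSpace.comp
    (isMorphism_subtype_val _)

variable {Y : Type*} [TopologicalSpace Y] [SpaceWithFunctions k Y]

/-- A morphism to the vector space with values in the nonzero vectors is a morphism to the
space of frames. -/
theorem isMorphism_ofVec {φ : Y → W} (hφ : IsMorphism k (fun y => AffSpace.of k (φ y)))
    (h : ∀ y, φ y ≠ 0) : IsMorphism k (fun y => (ofVec (φ y) (h y) : Frame k 1 W)) :=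
  ((LinearMap.pi (R := k) (φ := fun _ : Fin 1 => W)
    fun _ => LinearMap.id).isMorphism_affSpace.comp hφ).codRestrict _

theorem ofFrame_eq_iff {F F' : Frame k 1 W} :
    Gr.ofFrame F = Gr.ofFrame F' ↔ ∃ c : k, c ≠ 0 ∧ F'.vec = c • F.vec := by
  constructor
  · intro h
    have h1 : F'.vec ∈ (Gr.ofFrame F).toSubmodule := by
      rw [h, toSubmodule_ofFrame]
      exact Submodule.mem_span_singleton_self _
    rw [toSubmodule_ofFrame, Submodule.mem_span_singleton] at h1
    obtain ⟨c, hc⟩ := h1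
    refine ⟨c, ?_, hc.symm⟩
    rintro rfl
    exact F'.vec_ne_zero (by rw [← hc, zero_smul])
  · rintro ⟨c, hc, h⟩
    ext1
    rw [toSubmodule_ofFrame, toSubmodule_ofFrame, h,
      Submodule.span_singleton_smul_eq (isUnit_iff_ne_zero.2 hc)]

/-- The saturation of an open set is the union of its rescalings by the nonzero scalars, each of
which is open. -/
theorem isOpenMap_ofFrame : IsOpenMap (Gr.ofFrame : Frame k 1 W → Gr k 1 W) := by
  intro O hO
  refine isOpen_coinduced.2 ?_
  have : Gr.ofFrame ⁻¹' (Gr.ofFrame '' O) = ⋃ c : {c : k // c ≠ 0},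
      {F : Frame k 1 W | ofVec (c.1 • F.vec) (smul_ne_zero c.2 F.vec_ne_zero) ∈ O} := by
    ext F
    simp only [Set.mem_preimage, Set.mem_image, Set.mem_iUnion, Set.mem_ofPred_eq]
    constructor
    · rintro ⟨F', hF', h⟩
      obtain ⟨c, hc, h⟩ := ofFrame_eq_iff.1 h.symm
      refine ⟨⟨c, hc⟩, ?_⟩
      convert hF'
      exact vec_injective h.symm
    · rintro ⟨⟨c, hc⟩, h⟩
      exact ⟨_, h, (ofFrame_eq_iff.2 ⟨c, hc, rfl⟩).symm⟩
  rw [this]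
  refine isOpen_iUnion fun c => hO.preimage (IsMorphism.continuous (k := k) ?_)
  exact isMorphism_ofVec
    ((c.1 • LinearMap.id : W →ₗ[k] W).isMorphism_affSpace.comp isMorphism_vec) _

end Frame

/-! ### Linear subspaces and linear maps of projective spaces -/

namespace ProjSpace

variable {k : Type*} {W W' : Type*} [Field k] [AddCommGroup W] [Module k W] [AddCommGroup W']
  [Module k W']

theorem exists_ofVec (x : ProjSpace k W) :
    ∃ (w : W) (hw : w ≠ 0), x = Gr.ofFrame (Frame.ofVec w hw) := by
  obtain ⟨⟨v, hv⟩, h0, h⟩ := finrank_eq_one_iff'.1 x.finrank_toSubmodule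
  have h0' : v ≠ 0 := fun h => h0 (Subtype.ext h)
  refine ⟨v, h0', ?_⟩
  ext1
  rw [Frame.toSubmodule_ofFrame, Frame.vec_ofVec]
  refine le_antisymm (fun w hw => ?_) ?_
  · obtain ⟨c, hc⟩ := h ⟨w, hw⟩
    exact Submodule.mem_span_singleton.2 ⟨c, congrArg Subtype.val hc⟩
  · rwa [Submodule.span_singleton_le_iff_mem]

theorem ofFrame_surjective :
    Function.Surjective (Gr.ofFrame : Frame k 1 W → ProjSpace k W) := fun x => by
  obtain ⟨w, hw, rfl⟩ := exists_ofVec x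
  exact ⟨_, rfl⟩

theorem ofFrame_mem_linearSubspace {L : Submodule k W} {F : Frame k 1 W} :
    (Gr.ofFrame F : ProjSpace k W) ∈ linearSubspace L ↔ F.vec ∈ L := by
  change (Gr.ofFrame F).toSubmodule ≤ L ↔ _
  rw [Frame.toSubmodule_ofFrame, Submodule.span_singleton_le_iff_mem]

theorem linearSubspace_subset_iff {L L' : Submodule k W} :
    linearSubspace L ⊆ linearSubspace L' ↔ L ≤ L' := by
  refine ⟨fun h w hw => ?_, fun h x hx => le_trans hx h⟩
  by_cases hw0 : w = 0
  · simp [hw0]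
  · exact ofFrame_mem_linearSubspace.1 (h (ofFrame_mem_linearSubspace.2
      (show (Frame.ofVec w hw0 : Frame k 1 W).vec ∈ L from hw)))

theorem linearSubspace_nonempty_iff {L : Submodule k W} :
    (linearSubspace L).Nonempty ↔ L ≠ ⊥ := by
  constructor
  · rintro ⟨x, hx⟩ rfl
    obtain ⟨F, rfl⟩ := ofFrame_surjective x
    exact F.vec_ne_zero (ofFrame_mem_linearSubspace.1 hx)
  · intro h
    obtain ⟨w, hw, hw0⟩ := Submodule.exists_mem_ne_zero_of_ne_bot h
    exact ⟨_, ofFrame_mem_linearSubspace.2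
      (show (Frame.ofVec w hw0 : Frame k 1 W).vec ∈ L from hw)⟩

theorem isClosed_linearSubspace (L : Submodule k W) : IsClosed (linearSubspace L) := by
  refine isClosed_coinduced.2 ?_
  convert (AffSpace.isClosed_submodule L).preimage (Frame.isMorphism_vec (k := k)).continuous using 1
  ext F
  exact ofFrame_mem_linearSubspace

/-- The map between projective spaces induced by an injective linear map. -/
def map (j : W →ₗ[k] W') (hj : LinearMap.ker j = ⊥) (x : ProjSpace k W) : ProjSpace k W' :=
  ⟨x.toSubmodule.map j, by
    rw [← (Submodule.equivMapOfInjective j (LinearMap.ker_eq_bot.1 hj) x.toSubmodule).finrank_eq]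
    exact x.finrank_toSubmodule⟩

theorem toSubmodule_map (j : W →ₗ[k] W') (hj : LinearMap.ker j = ⊥) (x : ProjSpace k W) :
    (map j hj x).toSubmodule = x.toSubmodule.map j := rfl

theorem map_ofFrame_ofVec (j : W →ₗ[k] W') (hj : LinearMap.ker j = ⊥) (F : Frame k 1 W) :
    map j hj (Gr.ofFrame F) = Gr.ofFrame (Frame.ofVec (j F.vec)
      fun h => F.vec_ne_zero (LinearMap.ker_eq_bot'.1 hj _ h)) := by
  ext1
  rw [toSubmodule_map, Frame.toSubmodule_ofFrame, Frame.toSubmodule_ofFrame, Frame.vec_ofVec,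
    Submodule.map_span, Set.image_singleton]

theorem isMorphism_map (j : W →ₗ[k] W') (hj : LinearMap.ker j = ⊥) :
    IsMorphism k (map j hj) := by
  refine Gr.isMorphism_of_frame ?_
  simp only [map_ofFrame_ofVec]
  exact Gr.isMorphism_ofFrame.comp
    (Frame.isMorphism_ofVec (j.isMorphism_affSpace.comp Frame.isMorphism_vec) _)

theorem range_map (j : W →ₗ[k] W') (hj : LinearMap.ker j = ⊥) :
    Set.range (map j hj) = linearSubspace (LinearMap.range j) := by
  ext x
  constructor
  · rintro ⟨x, rfl⟩
    exact LinearMap.map_le_range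
  · intro hx
    obtain ⟨F, rfl⟩ := ofFrame_surjective x
    obtain ⟨w, hw⟩ := ofFrame_mem_linearSubspace.1 hx
    have hw0 : w ≠ 0 := by
      rintro rfl
      exact F.vec_ne_zero (by rw [← hw, map_zero])
    refine ⟨Gr.ofFrame (Frame.ofVec w hw0), ?_⟩
    rw [map_ofFrame_ofVec]
    congr 1
    exact Frame.vec_injective hw

theorem map_injective (j : W →ₗ[k] W') (hj : LinearMap.ker j = ⊥) :
    Function.Injective (map j hj) := by
  intro x y h
  ext1
  exact Submodule.map_injective_of_injective (LinearMap.ker_eq_bot.1 hj)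
    (congrArg Gr.toSubmodule h)

/-- The linear subspace given by the range of an injective linear map has a morphism inverse to
the induced map of projective spaces. -/
theorem exists_retraction (j : W →ₗ[k] W') (hj : LinearMap.ker j = ⊥) :
    ∃ ρ : linearSubspace (LinearMap.range j) → ProjSpace k W,
      IsMorphism k ρ ∧ ∀ x, map j hj (ρ x) = x.1 := by
  -- The inverse is the linear projection with centre `ker p` for a left inverse `p` of `j`. It is
  -- defined on the open complement `U` of the centre, which contains the image of `j`.
  obtain ⟨p, hp⟩ := j.exists_leftInverse_of_injective hj
  have hpj : ∀ w, p (j w) = w := fun w => LinearMap.congr_fun hp w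
  let U : Set (ProjSpace k W') := (linearSubspace (LinearMap.ker p))ᶜ
  have hU : IsOpen U := (isClosed_linearSubspace _).isOpen_compl
  have hne : ∀ F : Frame k 1 W', (Gr.ofFrame F : ProjSpace k W') ∈ U → p F.vec ≠ 0 :=
    fun F hF h => hF (ofFrame_mem_linearSubspace.2 h)
  have hspan : ∀ F : Frame k 1 W', (Gr.ofFrame F).toSubmodule.map p =
      Submodule.span k {p F.vec} := fun F => by
    rw [Frame.toSubmodule_ofFrame, Submodule.map_span, Set.image_singleton]
  let Φ : U → ProjSpace k W := fun x => ⟨x.1.toSubmodule.map p, by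
    obtain ⟨x, hx⟩ := x
    obtain ⟨F, rfl⟩ := ofFrame_surjective x
    rw [hspan]
    exact finrank_span_singleton (hne F hx)⟩
  have hΦF : ∀ F : {F : Frame k 1 W' // Gr.ofFrame F ∈ U},
      Φ ⟨Gr.ofFrame F.1, F.2⟩ = Gr.ofFrame (Frame.ofVec (p F.1.vec) (hne F.1 F.2)) := by
    intro F
    ext1
    rw [Frame.toSubmodule_ofFrame, Frame.vec_ofVec]
    exact hspan F.1
  have hΦ : IsMorphism k Φ := by
    refine Gr.isMorphism_of_isOpen hU ?_
    simp only [hΦF]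
    exact Gr.isMorphism_ofFrame.comp (Frame.isMorphism_ofVec
      ((p.isMorphism_affSpace.comp Frame.isMorphism_vec).comp (isMorphism_subtype_val _)) _)
  have hmap : ∀ x : ProjSpace k W, map j hj x ∈ U := by
    intro x hx
    obtain ⟨F, rfl⟩ := ofFrame_surjective x
    rw [map_ofFrame_ofVec, ofFrame_mem_linearSubspace, Frame.vec_ofVec, LinearMap.mem_ker,
      hpj] at hx
    exact F.vec_ne_zero hx
  have hsub : ∀ x, x ∈ linearSubspace (LinearMap.range j) → x ∈ U := by
    rw [← range_map j hj]
    rintro _ ⟨x, rfl⟩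
    exact hmap x
  refine ⟨fun x => Φ ⟨x.1, hsub x.1 x.2⟩,
    hΦ.comp ((isMorphism_subtype_val _).codRestrict fun x => hsub x.1 x.2), ?_⟩
  rintro ⟨x, hx⟩
  obtain ⟨y, rfl⟩ := (range_map j hj).symm ▸ hx
  congr 1
  ext1
  change (y.toSubmodule.map j).map p = y.toSubmodule
  rw [← Submodule.map_comp, hp, Submodule.map_id]

theorem isomorphic_linearSubspace (j : W →ₗ[k] W') (hj : LinearMap.ker j = ⊥) :
    Isomorphic k (linearSubspace (LinearMap.range j)) (ProjSpace k W) := by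
  obtain ⟨ρ, hρ, h⟩ := exists_retraction j hj
  have hm : ∀ x, map j hj x ∈ linearSubspace (LinearMap.range j) := fun x =>
    range_map j hj ▸ Set.mem_range_self x
  refine isomorphic_of_isMorphism
    ⟨ρ, fun x => ⟨map j hj x, hm x⟩, fun x => Subtype.ext (h x), fun x => ?_⟩ hρ
    ((isMorphism_map j hj).codRestrict hm)
  exact map_injective j hj (h _)

/-- The frames are the nonzero vectors, a nonempty open subset of an irreducible affine space, and
projective space is a continuous image of them. -/
instance irreducibleSpace [Infinite k] [Nontrivial W] : IrreducibleSpace (ProjSpace k W) := by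
  have h1 : IsOpen {F : AffSpace k (Fin 1 → W) | LinearIndependent k F.vec} := by
    have h := (AffSpace.isClosed_submodule (k := k) (⊥ : Submodule k (Fin 1 → W))).isOpen_compl
    convert h using 1
    ext F
    rw [Set.mem_ofPred_eq, linearIndependent_unique_iff]
    change F.vec 0 ≠ 0 ↔ ¬ F.vec = 0
    rw [not_iff_not, funext_iff, Fin.forall_fin_one]
    rfl
  obtain ⟨w, hw⟩ := exists_ne (0 : W)
  have h2 : IrreducibleSpace (Frame k 1 W) := by
    refine Subtype.irreducibleSpace (s := {F : AffSpace k (Fin 1 → W) | LinearIndependent k F.vec})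
      ⟨⟨_, (Frame.ofVec w hw : Frame k 1 W).2⟩, ?_⟩
    exact (PreirreducibleSpace.isPreirreducible_univ).open_subset h1 (Set.subset_univ _)
  exact ofFrame_surjective.irreducibleSpace Gr.continuous_ofFrame

theorem isIrreducible_linearSubspace [Infinite k] {L : Submodule k W} (hL : L ≠ ⊥) :
    IsIrreducible (linearSubspace L) := by
  have := Submodule.nontrivial_iff_ne_bot.2 hL
  have h := range_map L.subtype L.ker_subtype
  rw [Submodule.range_subtype] at h
  rw [← h, ← Set.image_univ]
  exact (IrreducibleSpace.isIrreducible_univ _).image _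
    (isMorphism_map _ _).continuous.continuousOn

/-! ## The dimension of projective space -/

section Dimension

variable {n : ℕ}

theorem eval_mem_polyFun (P : MvPolynomial (Fin n) k) :
    (fun x : AffSpace k (Fin n → k) => MvPolynomial.eval x.vec P) ∈ polyFun k (Fin n → k) := by
  induction P using MvPolynomial.induction_on with
  | C a =>
    simp only [MvPolynomial.eval_C]
    exact (polyFun k (Fin n → k)).algebraMap_mem a
  | add p q hp hq =>
    simp only [map_add]
    exact add_mem hp hq
  | mul_X p i hp =>
    simp only [map_mul, MvPolynomial.eval_X]
    exact mul_mem hp (polyFun.dual_mem (LinearMap.proj i : (Fin n → k) →ₗ[k] k))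

theorem exists_eval_of_mem_polyFun {p : AffSpace k (Fin n → k) → k}
    (hp : p ∈ polyFun k (Fin n → k)) :
    ∃ P : MvPolynomial (Fin n) k, ∀ x, p x = MvPolynomial.eval x.vec P := by
  refine polyFun.induction (P := fun p => ∃ P : MvPolynomial (Fin n) k, ∀ x : AffSpace k _,
    p x = MvPolynomial.eval x.vec P) hp (fun φ => ?_) (fun c => ⟨MvPolynomial.C c, by simp⟩) ?_ ?_
  · refine ⟨∑ i, MvPolynomial.X i * MvPolynomial.C (φ fun j => if i = j then 1 else 0),
      fun x => (LinearMap.pi_apply_eq_sum_univ φ x.vec).trans ?_⟩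
    simp
  · rintro p q ⟨P, hP⟩ ⟨Q, hQ⟩
    exact ⟨P + Q, fun x => by rw [map_add, ← hP, ← hQ]; rfl⟩
  · rintro p q ⟨P, hP⟩ ⟨Q, hQ⟩
    exact ⟨P * Q, fun x => by rw [map_mul, ← hP, ← hQ]; rfl⟩

/-- The ideal of the polynomials which vanish on the cone over a subset of projective space. -/
def coneIdeal (Z : Set (ProjSpace k (Fin n → k))) : Ideal (MvPolynomial (Fin n) k) where
  carrier := {P | ∀ F : Frame k 1 (Fin n → k), Gr.ofFrame F ∈ Z → MvPolynomial.eval F.vec P = 0}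
  zero_mem' F _ := map_zero _
  add_mem' hP hQ F hF := by rw [map_add, hP F hF, hQ F hF, add_zero]
  smul_mem' R P hP F hF := by rw [smul_eq_mul, map_mul, hP F hF, mul_zero]

theorem mem_coneIdeal {Z : Set (ProjSpace k (Fin n → k))} {P : MvPolynomial (Fin n) k} :
    P ∈ coneIdeal Z ↔
      ∀ F : Frame k 1 (Fin n → k), Gr.ofFrame F ∈ Z → MvPolynomial.eval F.vec P = 0 := Iff.rfl

/-- This replaces the decomposition into homogeneous components: a polynomial is studied on the line
through `v` as a polynomial in the scalar. -/
theorem exists_polynomial_scalar (P : MvPolynomial (Fin n) k) (v : Fin n → k) :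
    ∃ p : Polynomial k, ∀ t : k, MvPolynomial.eval (t • v) P = p.eval t := by
  obtain ⟨p, hp⟩ := polyFun.exists_polynomial_line (eval_mem_polyFun P) (0 : Fin n → k) v
  refine ⟨p, fun t => ?_⟩
  rw [← hp t, zero_add]
  rfl

theorem _root_.Polynomial.exists_eval_ne_zero' [Infinite k] {p : Polynomial k} (hp : p ≠ 0) :
    ∃ t : k, t ≠ 0 ∧ p.eval t ≠ 0 := by
  obtain ⟨t, ht⟩ := Polynomial.exists_eval_ne_zero_of_natDegree_lt_card (Polynomial.X * p)
    (mul_ne_zero Polynomial.X_ne_zero hp)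
    (lt_of_lt_of_le Cardinal.natCast_lt_aleph0 (Cardinal.aleph0_le_mk k))
  rw [Polynomial.eval_mul, Polynomial.eval_X] at ht
  exact ⟨t, left_ne_zero_of_mul ht, right_ne_zero_of_mul ht⟩

theorem isOpen_image_eval_ne_zero (P : MvPolynomial (Fin n) k) :
    IsOpen (Gr.ofFrame '' {F : Frame k 1 (Fin n → k) | MvPolynomial.eval F.vec P ≠ 0}) := by
  refine Frame.isOpenMap_ofFrame _ ?_
  exact IsOpen.preimage (Frame.isMorphism_vec (k := k)).continuous
    (TopologicalSpace.isOpen_generateFrom_of_mem ⟨_, eval_mem_polyFun P, rfl⟩)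

/-- If neither `P` nor `Q` vanishes on the cone, irreducibility gives a point of `Z` with a
representative where `P` is nonzero and a representative where `Q` is nonzero. These are
proportional, so `P` and `Q` are nonzero polynomials along the line through them, and some nonzero
multiple makes `P * Q` nonzero. -/
theorem coneIdeal_isPrime [Infinite k] {Z : Set (ProjSpace k (Fin n → k))}
    (hZ : IsIrreducible Z) : (coneIdeal Z).IsPrime := by
  refine Ideal.isPrime_iff.2 ⟨?_, fun {P Q} hPQ => ?_⟩
  · rw [Ideal.ne_top_iff_one]
    intro h
    obtain ⟨x, hx⟩ := hZ.nonempty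
    obtain ⟨F, rfl⟩ := ofFrame_surjective x
    exact one_ne_zero ((map_one (MvPolynomial.eval F.vec)).symm.trans (h F hx))
  · by_contra! h
    obtain ⟨hP, hQ⟩ := h
    simp only [mem_coneIdeal, not_forall] at hP hQ
    obtain ⟨F, hFZ, hF⟩ := hP
    obtain ⟨F', hFZ', hF'⟩ := hQ
    obtain ⟨x, hxZ, ⟨G, hG, rfl⟩, ⟨G', hG', h⟩⟩ := hZ.isPreirreducible _ _
      (isOpen_image_eval_ne_zero P) (isOpen_image_eval_ne_zero Q)
      ⟨_, hFZ, F, hF, rfl⟩ ⟨_, hFZ', F', hF', rfl⟩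
    obtain ⟨c, hc, hcG⟩ := Frame.ofFrame_eq_iff.1 h.symm
    obtain ⟨p, hp⟩ := exists_polynomial_scalar P G.vec
    obtain ⟨q, hq⟩ := exists_polynomial_scalar Q G.vec
    have hp0 : p ≠ 0 := by
      rintro rfl
      refine hG ?_
      have := hp 1
      rwa [one_smul, Polynomial.eval_zero] at this
    have hq0 : q ≠ 0 := by
      rintro rfl
      refine hG' ?_
      have := hq c
      rwa [← hcG, Polynomial.eval_zero] at this
    obtain ⟨t, ht, hpq⟩ := Polynomial.exists_eval_ne_zero' (mul_ne_zero hp0 hq0)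
    rw [Polynomial.eval_mul, ← hp, ← hq, ← map_mul] at hpq
    refine hpq (hPQ (Frame.ofVec (t • G.vec) (smul_ne_zero ht G.vec_ne_zero)) ?_)
    rw [← Frame.ofFrame_eq_iff.2 ⟨t, ht, rfl⟩]
    exact hxZ

/-- A point of `Z'` outside the closed set `Z` has a representative in a basic open set that misses
the cone over `Z`; its defining polynomial vanishes on that cone but not at the representative. -/
theorem coneIdeal_lt {Z Z' : Set (ProjSpace k (Fin n → k))} (hZ : IsClosed Z) (h : Z < Z') :
    coneIdeal Z' < coneIdeal Z := by
  obtain ⟨hle, x, hx, hxZ⟩ := Set.ssubset_iff_exists.1 h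
  refine lt_of_le_not_ge (fun P hP F hF => hP F (hle hF)) fun hle' => ?_
  obtain ⟨F, rfl⟩ := ofFrame_surjective x
  have hopen := hZ.isOpen_compl.preimage Gr.continuous_ofFrame
  obtain ⟨O, hO, hOF⟩ := isOpen_induced_iff.1 hopen
  have hFO : F.1 ∈ O := by
    change F ∈ Subtype.val ⁻¹' O
    rw [hOF]
    exact hxZ
  obtain ⟨_, ⟨p, hp, rfl⟩, hpF, hpO⟩ :=
    AffSpace.isTopologicalBasis.exists_subset_of_mem_open hFO hO
  -- `p` is a function on families indexed by `Fin 1`; composing with the constant family turns it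
  -- into a polynomial function on the vector space itself.
  have hc := IsPolynomialMap.comp_mem (k := k) (W := Fin n → k)
    (g := fun x => AffSpace.of k fun _ : Fin 1 => x.vec) (fun φ => polyFun.dual_mem
      (φ ∘ₗ LinearMap.pi (R := k) (φ := fun _ : Fin 1 => Fin n → k) fun _ => LinearMap.id)) hp
  obtain ⟨P, hP⟩ := exists_eval_of_mem_polyFun hc
  have hPF : ∀ F : Frame k 1 (Fin n → k), p F.1 = MvPolynomial.eval F.vec P := by
    intro F
    rw [← AffSpace.vec_of (k := k) F.vec, ← hP]
    refine congrArg p (funext fun i => ?_)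
    rw [Subsingleton.elim i 0]
    rfl
  have hPZ : P ∈ coneIdeal Z := by
    intro G hG
    by_contra h0
    rw [← hPF] at h0
    have : G ∈ Subtype.val ⁻¹' O := hpO h0
    rw [hOF] at this
    exact this hG
  exact hpF ((hPF F).trans (hle' hPZ F hx))

/-- The cone over a nonempty set contains a line minus the origin. A polynomial vanishing there has
infinitely many zeros in the scalar and so vanishes at the origin, whereas some coordinate vanishes
at the origin but not on the line. -/
theorem coneIdeal_lt_ker_eval_zero [Infinite k] {Z : Set (ProjSpace k (Fin n → k))}
    (hZ : Z.Nonempty) :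
    coneIdeal Z < RingHom.ker (MvPolynomial.eval (0 : Fin n → k)) := by
  obtain ⟨x, hx⟩ := hZ
  obtain ⟨F, rfl⟩ := ofFrame_surjective x
  refine lt_of_le_not_ge (fun P hP => ?_) fun hle => ?_
  · obtain ⟨p, hp⟩ := exists_polynomial_scalar P F.vec
    rw [RingHom.mem_ker, ← zero_smul k F.vec, hp]
    suffices p = 0 by rw [this, Polynomial.eval_zero]
    by_contra h0
    obtain ⟨t, ht, hpt⟩ := Polynomial.exists_eval_ne_zero' h0
    rw [← hp] at hpt
    refine hpt (hP (Frame.ofVec (t • F.vec) (smul_ne_zero ht F.vec_ne_zero)) ?_)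
    rwa [← Frame.ofFrame_eq_iff.2 ⟨t, ht, rfl⟩]
  · refine F.vec_ne_zero (funext fun i => ?_)
    have h := hle (show MvPolynomial.X i ∈ _ by simp [RingHom.mem_ker]) F hx
    simpa using h

theorem topologicalKrullDim_le [Infinite k] (d : ℕ) :
    topologicalKrullDim (ProjSpace k (Fin (d + 1) → k)) ≤ d := by
  refine iSup_le fun s => ?_
  let g : TopologicalSpace.IrreducibleCloseds (ProjSpace k (Fin (d + 1) → k)) →
      (PrimeSpectrum (MvPolynomial (Fin (d + 1)) k))ᵒᵈ :=
    fun Z => OrderDual.toDual ⟨coneIdeal Z, coneIdeal_isPrime Z.isIrreducible⟩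
  have hg : StrictMono g := fun Z Z' h => coneIdeal_lt Z.isClosed h
  -- The ideal of the origin strictly contains every cone ideal, so it goes in front of the chain in
  -- the reversed order. This extra member accounts for the passage from `d + 1` variables to
  -- dimension `d`.
  let q := (s.map g hg).cons (OrderDual.toDual
    ⟨RingHom.ker (MvPolynomial.eval (0 : Fin (d + 1) → k)), RingHom.ker_isPrime _⟩)
    (coneIdeal_lt_ker_eval_zero s.head.isIrreducible.nonempty)
  have h1 := Order.LTSeries.length_le_krullDim q
  have h2 : ringKrullDim (MvPolynomial (Fin (d + 1)) k) = ((d + 1 : ℕ) : WithBot ℕ∞) := by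
    rw [MvPolynomial.ringKrullDim_of_isNoetherianRing, ringKrullDim_eq_zero_of_field]
    simp
  rw [Order.krullDim_orderDual, show Order.krullDim _ = _ from h2] at h1
  have h3 : q.length = s.length + 1 := by
    simp [q, RelSeries.cons, RelSeries.append, LTSeries.map]
  rw [h3] at h1
  have h4 : s.length + 1 ≤ d + 1 := by exact_mod_cast h1
  exact_mod_cast Nat.le_of_succ_le_succ h4

/-- A complete flag of coordinate subspaces gives a chain of `d + 1` linear subspaces. -/
theorem le_topologicalKrullDim [Infinite k] (d : ℕ) :
    (d : WithBot ℕ∞) ≤ topologicalKrullDim (ProjSpace k (Fin (d + 1) → k)) := by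
  let L : Fin (d + 1) → Submodule k (Fin (d + 1) → k) := fun i =>
    { carrier := {v | ∀ j, i < j → v j = 0}
      zero_mem' := fun j _ => rfl
      add_mem' := fun hv hw j hj => by simp [hv j hj, hw j hj]
      smul_mem' := fun c v hv j hj => by simp [hv j hj] }
  have hs : ∀ i, Pi.single i 1 ∈ L i := fun i j hj => Pi.single_eq_of_ne hj.ne' 1
  have hL0 : ∀ i, L i ≠ ⊥ := fun i h => by
    have h1 := hs i
    rw [h, Submodule.mem_bot, Pi.single_eq_zero_iff] at h1
    exact one_ne_zero h1
  have hL : StrictMono L := by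
    intro i i' h
    refine lt_of_le_not_ge (fun v hv j hj => hv j (h.trans hj)) fun hle => ?_
    have h1 := hle (hs i') i' h
    rw [Pi.single_eq_same] at h1
    exact one_ne_zero h1
  let s : LTSeries (TopologicalSpace.IrreducibleCloseds (ProjSpace k (Fin (d + 1) → k))) :=
    LTSeries.mk d (fun i => ⟨linearSubspace (L i), isIrreducible_linearSubspace (hL0 i),
      isClosed_linearSubspace _⟩) (by
        intro i i' h
        refine lt_of_le_not_ge (linearSubspace_subset_iff.2 (hL h).le) fun hle => ?_
        exact (hL h).not_ge (linearSubspace_subset_iff.1 hle))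
  exact Order.LTSeries.length_le_krullDim s

theorem topologicalKrullDim_eq [Infinite k] (d : ℕ) :
    topologicalKrullDim (ProjSpace k (Fin (d + 1) → k)) = d :=
  le_antisymm (topologicalKrullDim_le d) (le_topologicalKrullDim d)

end Dimension

end ProjSpace

/-! ## Hyperplanes and linear forms -/

namespace Gr

variable {k : Type*} {m : ℕ} {W : Type*} [Field k] [AddCommGroup W] [Module k W]

theorem toSubmodule_injective : Function.Injective (toSubmodule : Gr k m W → Submodule k W) :=
  fun _ _ h => ext h

theorem span_singleton_eq_dualAnnihilator [FiniteDimensional k W]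
    (hW : Module.finrank k W = m + 1) {A : Submodule k W} (hA : Module.finrank k A = m)
    {f : Module.Dual k W} (hf : f ≠ 0) (h : ∀ w ∈ A, f w = 0) :
    Submodule.span k {f} = A.dualAnnihilator := by
  refine Submodule.eq_of_le_of_finrank_eq ?_ ?_
  · rw [Submodule.span_singleton_le_iff_mem, Submodule.mem_dualAnnihilator]
    exact h
  · have h1 := Subspace.finrank_add_finrank_dualAnnihilator_eq A
    have h2 : Module.finrank k (Submodule.span k {f}) = 1 := finrank_span_singleton hf
    lia

/-- The correspondence between hyperplanes and lines of linear forms. -/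
def hyperplaneEquiv [FiniteDimensional k W] (hW : Module.finrank k W = m + 1) :
    Gr k m W ≃ ProjSpace k (Module.Dual k W) where
  toFun A := ⟨A.toSubmodule.dualAnnihilator, by
    have h1 := Subspace.finrank_add_finrank_dualAnnihilator_eq A.toSubmodule
    rw [A.finrank_toSubmodule] at h1
    lia⟩
  invFun x := ⟨x.toSubmodule.dualCoannihilator, by
    have h1 := Subspace.finrank_add_finrank_dualCoannihilator_eq x.toSubmodule
    rw [x.finrank_toSubmodule] at h1
    lia⟩
  left_inv A := toSubmodule_injective Subspace.dualAnnihilator_dualCoannihilator_eq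
  right_inv x := toSubmodule_injective Subspace.dualCoannihilator_dualAnnihilator_eq

theorem toSubmodule_hyperplaneEquiv [FiniteDimensional k W] (hW : Module.finrank k W = m + 1)
    (A : Gr k m W) : (hyperplaneEquiv hW A).toSubmodule = A.toSubmodule.dualAnnihilator := rfl

/-- The linear form `w ↦ det (w, v₁, …, vₘ)`. -/
def detForm (b : Module.Basis (Fin (m + 1)) k W) (v : Fin m → W) : Module.Dual k W :=
  b.det.toMultilinearMap.toLinearMap (Fin.cons 0 v) 0

theorem detForm_apply (b : Module.Basis (Fin (m + 1)) k W) (v : Fin m → W) (w : W) :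
    detForm b v w = b.det (Fin.cons w v) := by
  change b.det (Function.update (Fin.cons 0 v) 0 w) = _
  rw [Fin.update_cons_zero]

theorem detForm_apply_self (b : Module.Basis (Fin (m + 1)) k W) (v : Fin m → W) (i : Fin m) :
    detForm b v (v i) = 0 := by
  rw [detForm_apply]
  exact b.det.map_eq_zero_of_eq _ (i := 0) (j := i.succ) (by simp) (Fin.succ_ne_zero i).symm

/-- A vector outside the span of `v` completes `v` to a basis, and the determinant of a basis is a
unit. -/
theorem detForm_ne_zero (b : Module.Basis (Fin (m + 1)) k W) {v : Fin m → W}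
    (hv : LinearIndependent k v) : detForm b v ≠ 0 := by
  have hW : Module.finrank k W = m + 1 := by simp [Module.finrank_eq_card_basis b]
  have hfd := Module.Finite.of_basis b
  have h1 : Submodule.span k (Set.range v) ≠ ⊤ := fun h => by
    have h2 := finrank_span_eq_card hv
    rw [h, finrank_top, hW, Fintype.card_fin] at h2
    lia
  obtain ⟨w, -, hw⟩ := SetLike.exists_of_lt (lt_top_iff_ne_top.2 h1)
  have h2 : LinearIndependent k (Fin.cons w v : Fin (m + 1) → W) :=
    linearIndependent_finCons.2 ⟨hv, hw⟩
  have h3 := b.is_basis_iff_det.1 ⟨h2, h2.span_eq_top_of_card_eq_finrank (by simp [hW])⟩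
  intro h0
  rw [← detForm_apply, h0] at h3
  exact not_isUnit_zero h3

theorem isPolynomialMap_detForm (b : Module.Basis (Fin (m + 1)) k W) :
    IsPolynomialMap k (fun x : AffSpace k (Fin m → W) => AffSpace.of k (detForm b x.vec)) := by
  have hfd := Module.Finite.of_basis b
  intro φ
  -- Linear forms on the dual are evaluations at vectors `w`, so the Leibniz expansion of `det (w,
  -- v₁, …, vₘ)` shows that the map is polynomial in `v`.
  obtain ⟨w, rfl⟩ := (Module.evalEquiv k W).surjective φ
  have : (fun x : AffSpace k (Fin m → W) =>
      Module.evalEquiv k W w (AffSpace.of k (detForm b x.vec))) = ∑ σ : Equiv.Perm (Fin (m + 1)),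
        (Equiv.Perm.sign σ : ℤ) • ∏ j, fun x : AffSpace k (Fin m → W) =>
          b.repr ((Fin.cons w x.vec : Fin (m + 1) → W) j) (σ j) := by
    ext x
    change detForm b x.vec w = _
    rw [detForm_apply, Module.Basis.det_apply, Matrix.det_apply]
    simp only [Finset.sum_apply, Pi.smul_apply, Finset.prod_apply, Module.Basis.toMatrix_apply,
      Units.smul_def]
  rw [this]
  refine sum_mem fun σ _ => zsmul_mem (prod_mem fun j _ => ?_) _
  refine Fin.cases ?_ (fun i => ?_) j
  · simp only [Fin.cons_zero]
    exact (polyFun k _).algebraMap_mem _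
  · simp only [Fin.cons_succ]
    exact polyFun.dual_mem (b.coord (σ i.succ) ∘ₗ LinearMap.proj i : (Fin m → W) →ₗ[k] k)

/-- On frames the correspondence lifts globally to the polynomial map sending `v` to the form `det
(·, v₁, …, vₘ)`. -/
theorem isMorphism_hyperplaneEquiv [FiniteDimensional k W]
    (hW : Module.finrank k W = m + 1) : IsMorphism k (hyperplaneEquiv hW : Gr k m W → _) := by
  let b := Module.finBasisOfFinrankEq k W hW
  have h : ∀ F : Frame k m W, hyperplaneEquiv hW (ofFrame F) =
      ofFrame (Frame.ofVec (detForm b F.1.vec) (detForm_ne_zero b F.2)) := by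
    intro F
    apply toSubmodule_injective
    rw [Frame.toSubmodule_ofFrame, Frame.vec_ofVec, toSubmodule_hyperplaneEquiv]
    refine (span_singleton_eq_dualAnnihilator hW (ofFrame F).finrank_toSubmodule
      (detForm_ne_zero b F.2) fun w hw => ?_).symm
    rw [toSubmodule_ofFrame] at hw
    have : Submodule.span k (Set.range F.1.vec) ≤ LinearMap.ker (detForm b F.1.vec) := by
      rw [Submodule.span_le]
      rintro _ ⟨i, rfl⟩
      exact detForm_apply_self b _ i
    exact this hw
  refine isMorphism_of_frame ?_
  simp only [h]
  exact isMorphism_ofFrame.comp (Frame.isMorphism_ofVec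
    ((isPolynomialMap_detForm b).isMorphism.comp (isMorphism_subtype_val _)) _)

/-- Here the lift to frames is only local. With `f₀ w₀ ≠ 0` and a basis `u` of `ker f₀`, the vectors
`f w₀ • u i - f (u i) • w₀` lie in `ker f`, depend linearly on `f`, and are independent wherever `f
w₀ ≠ 0`. -/
theorem isMorphism_hyperplaneEquiv_symm [FiniteDimensional k W]
    (hW : Module.finrank k W = m + 1) :
    IsMorphism k ((hyperplaneEquiv hW).symm : _ → Gr k m W) := by
  refine isMorphism_of_frame (isMorphism_of_locally fun F₀ => ?_)
  have hf₀ := F₀.vec_ne_zero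
  set f₀ := F₀.vec
  obtain ⟨w₀, hw₀⟩ : ∃ w₀, f₀ w₀ ≠ 0 := by
    by_contra! h
    exact hf₀ (LinearMap.ext h)
  have hker : Module.finrank k (LinearMap.ker f₀) = m := by
    have h1 := f₀.finrank_range_add_finrank_ker
    rw [LinearMap.range_eq_top.2 (LinearMap.surjective hf₀), finrank_top,
      Module.finrank_self] at h1
    lia
  let u := Module.finBasisOfFinrankEq k (LinearMap.ker f₀) hker
  have hu : LinearIndependent k fun i => (u i : W) :=
    u.linearIndependent.map' (LinearMap.ker f₀).subtype (Submodule.ker_subtype _)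
  let g : Module.Dual k W →ₗ[k] (Fin m → W) := LinearMap.pi fun i =>
    LinearMap.toSpanSingleton k W (u i) ∘ₗ Module.Dual.eval k W w₀ -
      LinearMap.toSpanSingleton k W w₀ ∘ₗ Module.Dual.eval k W (u i)
  have hg : ∀ f i, g f i = f w₀ • (u i : W) - f (u i) • w₀ := fun f i => rfl
  have hli : ∀ f : Module.Dual k W, f w₀ ≠ 0 → LinearIndependent k (g f) := by
    intro f hf
    rw [Fintype.linearIndependent_iff] at hu ⊢
    intro c hc
    have h1 : ∑ i, c i • g f i = f w₀ • ∑ i, c i • (u i : W) - (∑ i, c i * f (u i)) • w₀ := by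
      simp only [hg, smul_sub, Finset.sum_sub_distrib, Finset.smul_sum, Finset.sum_smul, smul_smul,
        mul_comm]
    -- `f₀` kills every `u i` and so isolates the coefficient of `w₀`; once that vanishes, the
    -- independence of `u` finishes.
    have h2 : f₀ (∑ i, c i • g f i) = -((∑ i, c i * f (u i)) * f₀ w₀) := by
      rw [h1]
      simp only [map_sub, map_smul, map_sum, LinearMap.mem_ker.1 (u _).2, mul_zero,
        Finset.sum_const_zero, zero_sub, smul_eq_mul]
    rw [hc, map_zero, zero_eq_neg, mul_eq_zero, or_iff_left hw₀] at h2
    rw [h2, zero_smul, sub_zero, hc] at h1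
    exact hu c ((smul_eq_zero.1 h1.symm).resolve_left hf)
  let U : Set (Frame k 1 (Module.Dual k W)) := {F | F.vec w₀ ≠ 0}
  have hU : IsOpen U := by
    refine IsOpen.preimage (Frame.isMorphism_vec (k := k)).continuous
      (TopologicalSpace.isOpen_generateFrom_of_mem
        ⟨_, polyFun.dual_mem (Module.Dual.eval k W w₀), rfl⟩)
  let s : U → Frame k m W := fun F => ⟨AffSpace.of k (g F.1.vec), hli _ F.2⟩
  have hs : IsMorphism k s :=
    (g.isMorphism_affSpace.comp (Frame.isMorphism_vec.comp (isMorphism_subtype_val _))).codRestrict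
      fun F : U => hli _ F.2
  refine ⟨U, hU, hw₀, ?_⟩
  have h : ∀ F : U, (hyperplaneEquiv hW).symm (ofFrame F.1) = ofFrame (s F) := by
    intro F
    rw [Equiv.symm_apply_eq]
    apply toSubmodule_injective
    rw [Frame.toSubmodule_ofFrame, toSubmodule_hyperplaneEquiv]
    refine span_singleton_eq_dualAnnihilator hW (ofFrame (s F)).finrank_toSubmodule
      F.1.vec_ne_zero fun w hw => ?_
    rw [toSubmodule_ofFrame] at hw
    have : Submodule.span k (Set.range (g F.1.vec)) ≤ LinearMap.ker F.1.vec := by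
      rw [Submodule.span_le]
      rintro _ ⟨i, rfl⟩
      simp only [SetLike.mem_coe, LinearMap.mem_ker, hg, map_sub, map_smul, smul_eq_mul]
      ring
    exact this hw
  simp only [h]
  exact isMorphism_ofFrame.comp hs

end Gr

/-! ## The structure of `T₂Q` -/

namespace PathAlgebra

variable {k V : Type*} [Field k] [Quiver V]

variable (k) in
/-- The coefficient of a path. -/
def coeff (p : Σ a b : V, Path a b) : PathAlgebra k V →ₗ[k] k := Finsupp.lapply p

theorem coeff_of_self (p : Σ a b : V, Path a b) : coeff k p (of k p) = 1 :=
  Finsupp.single_eq_same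

theorem coeff_of_ne {p q : Σ a b : V, Path a b} (h : q ≠ p) : coeff k p (of k q) = 0 :=
  Finsupp.single_eq_of_ne h.symm

theorem bilinear_ext {f g : PathAlgebra k V →ₗ[k] PathAlgebra k V →ₗ[k] k}
    (h : ∀ p q, f (of k p) (of k q) = g (of k p) (of k q)) (x y : PathAlgebra k V) :
    f x y = g x y := by
  induction x using induction with
  | h0 => simp
  | hadd x x' hx hx' => simp [hx, hx']
  | hof c p =>
  induction y using induction with
  | h0 => simp
  | hadd y y' hy hy' => simp only [map_add, hy, hy']
  | hof d q => simp [h]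

variable (k) in
/-- The coefficient of the trivial path at a vertex. -/
abbrev vertexCoeff (v : V) : PathAlgebra k V →ₗ[k] k := coeff k ⟨v, v, Path.nil⟩

variable (k) in
/-- The coefficient of an arrow. -/
abbrev arrowCoeff {s t : V} (α : s ⟶ t) : PathAlgebra k V →ₗ[k] k := coeff k ⟨s, t, α.toPath⟩

open Classical in
theorem vertexCoeff_of_nil (v a : V) :
    vertexCoeff k v (of k ⟨a, a, Path.nil⟩) = if a = v then 1 else 0 := by
  split_ifs with h
  · subst h
    exact coeff_of_self _
  · exact coeff_of_ne fun h' => h (congrArg Sigma.fst h')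

/-- The length of a path, for paths with arbitrary end points. -/
def len (p : Σ a b : V, Path a b) : ℕ := p.2.2.length

theorem vertexCoeff_of_cons (v : V) {a b c : V} (p : Path a b) (e : b ⟶ c) :
    vertexCoeff k v (of k ⟨a, c, p.cons e⟩) = 0 :=
  coeff_of_ne fun h => by simpa [len] using congrArg len h

theorem arrowCoeff_of_nil {s t : V} (α : s ⟶ t) (a : V) :
    arrowCoeff k α (of k ⟨a, a, Path.nil⟩) = 0 :=
  coeff_of_ne fun h => by simpa [len, Hom.toPath] using congrArg len h

theorem arrowCoeff_of_cons_cons {s t : V} (α : s ⟶ t) {a b c d : V} (p : Path a b) (e : b ⟶ c)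
    (f : c ⟶ d) : arrowCoeff k α (of k ⟨a, d, (p.cons e).cons f⟩) = 0 :=
  coeff_of_ne fun h => by simpa [len, Hom.toPath] using congrArg len h

theorem arrowCoeff_of_eq_zero_of_ne_source {s t : V} (α : s ⟶ t) {a b : V} (p : Path a b)
    (h : a ≠ s) : arrowCoeff k α (of k ⟨a, b, p⟩) = 0 :=
  coeff_of_ne fun h' => h (congrArg Sigma.fst h')

theorem arrowCoeff_of_eq_zero_of_ne_target {s t : V} (α : s ⟶ t) {a b : V} (p : Path a b)
    (h : b ≠ t) : arrowCoeff k α (of k ⟨a, b, p⟩) = 0 :=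
  coeff_of_ne fun h' => h (congrArg (fun p : Σ a b : V, Path a b => p.2.1) h')

theorem pathMul_self {a b c : V} (p : Path a b) (q : Path b c) :
    pathMul k ⟨a, b, p⟩ ⟨b, c, q⟩ = of k ⟨a, c, p.comp q⟩ := by
  simp [pathMul]

theorem pathMul_of_ne {a b c d : V} (p : Path a b) (q : Path c d) (h : b ≠ c) :
    pathMul k ⟨a, b, p⟩ ⟨c, d, q⟩ = 0 := by
  simp [pathMul, h]

/-- Lengths add under composition, so a product of two paths is trivial only if both factors are the
same trivial path. -/
theorem vertexCoeff_mul (v : V) (x y : PathAlgebra k V) :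
    vertexCoeff k v (x * y) = vertexCoeff k v x * vertexCoeff k v y := by
  classical
  refine bilinear_ext (f := (mulHom k V).compr₂ (vertexCoeff k v))
    (g := (LinearMap.mul k k).compl₁₂ (vertexCoeff k v) (vertexCoeff k v)) ?_ x y
  rintro ⟨a, b, p⟩ ⟨c, d, q⟩
  change vertexCoeff k v (of k _ * of k _) = vertexCoeff k v (of k _) * vertexCoeff k v (of k _)
  rw [of_mul_of]
  by_cases h : b = c
  · subst h
    rw [pathMul_self]
    cases q with
    | nil =>
      cases p with
      | nil => simp [vertexCoeff_of_nil]
      | cons p e => simp [vertexCoeff_of_cons]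
    | cons q e => simp [vertexCoeff_of_cons]
  · rw [pathMul_of_ne _ _ h, map_zero]
    cases p with
    | nil =>
      cases q with
      | nil =>
        simp only [vertexCoeff_of_nil]
        split_ifs <;> simp_all
      | cons q e => simp [vertexCoeff_of_cons]
    | cons p e => simp [vertexCoeff_of_cons]

/-- An arrow factors only as its source vertex times itself or itself times its target vertex. This
is the origin of the twisted Leibniz rule for `pairForm`. -/
theorem arrowCoeff_mul {s t : V} (α : s ⟶ t) (x y : PathAlgebra k V) :
    arrowCoeff k α (x * y) =
      vertexCoeff k s x * arrowCoeff k α y + arrowCoeff k α x * vertexCoeff k t y := by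
  classical
  refine bilinear_ext (f := (mulHom k V).compr₂ (arrowCoeff k α))
    (g := (LinearMap.mul k k).compl₁₂ (vertexCoeff k s) (arrowCoeff k α) +
      (LinearMap.mul k k).compl₁₂ (arrowCoeff k α) (vertexCoeff k t)) ?_ x y
  rintro ⟨a, b, p⟩ ⟨c, d, q⟩
  change arrowCoeff k α (of k _ * of k _) = vertexCoeff k s (of k _) * arrowCoeff k α (of k _) +
    arrowCoeff k α (of k _) * vertexCoeff k t (of k _)
  rw [of_mul_of]
  by_cases h : b = c
  · subst h
    rw [pathMul_self]
    cases q with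
    | nil =>
      rw [Path.comp_nil, arrowCoeff_of_nil, mul_zero, zero_add, vertexCoeff_of_nil]
      split_ifs with h
      · rw [mul_one]
      · rw [mul_zero, arrowCoeff_of_eq_zero_of_ne_target _ _ h]
    | cons q e =>
      rw [vertexCoeff_of_cons, mul_zero, add_zero]
      cases p with
      | nil =>
        rw [Path.nil_comp, vertexCoeff_of_nil]
        split_ifs with h
        · rw [one_mul]
        · rw [zero_mul, arrowCoeff_of_eq_zero_of_ne_source _ _ h]
      | cons p f =>
        rw [vertexCoeff_of_cons, zero_mul, Path.comp_cons]
        cases q with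
        | nil => rw [Path.comp_nil, arrowCoeff_of_cons_cons]
        | cons q g => rw [Path.comp_cons, arrowCoeff_of_cons_cons]
  · rw [pathMul_of_ne _ _ h, map_zero]
    have h1 : vertexCoeff k s (of k ⟨a, b, p⟩) * arrowCoeff k α (of k ⟨c, d, q⟩) = 0 := by
      cases p with
      | nil =>
        rw [vertexCoeff_of_nil]
        split_ifs with h'
        · rw [arrowCoeff_of_eq_zero_of_ne_source _ _ (by rw [← h']; exact Ne.symm h), mul_zero]
        · rw [zero_mul]
      | cons p e => rw [vertexCoeff_of_cons, zero_mul]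
    have h2 : arrowCoeff k α (of k ⟨a, b, p⟩) * vertexCoeff k t (of k ⟨c, d, q⟩) = 0 := by
      cases q with
      | nil =>
        rw [vertexCoeff_of_nil]
        split_ifs with h'
        · rw [arrowCoeff_of_eq_zero_of_ne_target _ _ (by rw [← h']; exact h), zero_mul]
        · rw [mul_zero]
      | cons q e => rw [vertexCoeff_of_cons, mul_zero]
    rw [h1, h2, add_zero]

variable [Fintype V]

theorem vertexCoeff_of_mem_arrowIdeal {x : PathAlgebra k V} (hx : x ∈ arrowIdeal k V) (v : V) :
    vertexCoeff k v x = 0 := by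
  let I : TwoSidedIdeal (PathAlgebra k V) := TwoSidedIdeal.mk' {x | ∀ v, vertexCoeff k v x = 0}
    (fun v => map_zero _) (fun hx hy v => by rw [map_add, hx v, hy v, add_zero])
    (fun hx v => by rw [map_neg, hx v, neg_zero])
    (fun {x y} hy v => by rw [vertexCoeff_mul, hy v, mul_zero])
    (fun {x y} hx v => by rw [vertexCoeff_mul, hx v, zero_mul])
  have h : arrowIdeal k V ≤ I := by
    refine TwoSidedIdeal.span_le.2 ?_
    rintro _ ⟨s, t, α, rfl⟩
    exact (TwoSidedIdeal.mem_mk' ..).2 fun v => vertexCoeff_of_cons v _ _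
  exact (TwoSidedIdeal.mem_mk' ..).1 (h hx) v

/-- By the product formulas, the elements without terms of length at most one form a two-sided
ideal, and it contains the generators of `arrowIdealSq`. Hence vertex and arrow coefficients descend
to `T₂Q`. -/
theorem coeff_of_mem_arrowIdealSq {x : PathAlgebra k V} (hx : x ∈ arrowIdealSq k V) :
    (∀ v, vertexCoeff k v x = 0) ∧ ∀ (s t : V) (α : s ⟶ t), arrowCoeff k α x = 0 := by
  let I : TwoSidedIdeal (PathAlgebra k V) := TwoSidedIdeal.mk'
    {x | (∀ v, vertexCoeff k v x = 0) ∧ ∀ (s t : V) (α : s ⟶ t), arrowCoeff k α x = 0}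
    ⟨fun v => map_zero _, fun s t α => map_zero _⟩
    (fun hx hy => ⟨fun v => by rw [map_add, hx.1 v, hy.1 v, add_zero],
      fun s t α => by rw [map_add, hx.2 s t α, hy.2 s t α, add_zero]⟩)
    (fun hx => ⟨fun v => by rw [map_neg, hx.1 v, neg_zero],
      fun s t α => by rw [map_neg, hx.2 s t α, neg_zero]⟩)
    (fun {x y} hy => ⟨fun v => by rw [vertexCoeff_mul, hy.1 v, mul_zero],
      fun s t α => by rw [arrowCoeff_mul, hy.1 t, hy.2 s t α, mul_zero, mul_zero, add_zero]⟩)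
    (fun {x y} hx => ⟨fun v => by rw [vertexCoeff_mul, hx.1 v, zero_mul],
      fun s t α => by rw [arrowCoeff_mul, hx.1 s, hx.2 s t α, zero_mul, zero_mul, add_zero]⟩)
  have h : arrowIdealSq k V ≤ I := by
    refine TwoSidedIdeal.span_le.2 ?_
    rintro _ ⟨x, hx, y, hy, rfl⟩
    refine (TwoSidedIdeal.mem_mk' ..).2 ⟨fun v => ?_, fun s t α => ?_⟩
    · rw [vertexCoeff_mul, vertexCoeff_of_mem_arrowIdeal hx, zero_mul]
    · rw [arrowCoeff_mul, vertexCoeff_of_mem_arrowIdeal hx, vertexCoeff_of_mem_arrowIdeal hy,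
        zero_mul, mul_zero, add_zero]
  have h1 := (TwoSidedIdeal.mem_mk' _ _ _ _ _ _ x).1 (h hx)
  exact h1

theorem of_mem_arrowIdeal {a b c : V} (p : Path a b) (e : b ⟶ c) :
    of k ⟨a, c, p.cons e⟩ ∈ arrowIdeal k V := by
  have h : of k ⟨a, c, p.cons e⟩ = of k ⟨a, b, p⟩ * arrow k e := by
    rw [arrow, of_mul_of, pathMul_self]
    rfl
  rw [h]
  exact TwoSidedIdeal.mul_mem_left _ _ _ (TwoSidedIdeal.subset_span ⟨b, c, e, rfl⟩)

theorem of_mem_arrowIdealSq {a b c d : V} (p : Path a b) (e : b ⟶ c) (f : c ⟶ d) :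
    of k ⟨a, d, (p.cons e).cons f⟩ ∈ arrowIdealSq k V := by
  refine TwoSidedIdeal.subset_span ⟨of k ⟨a, c, p.cons e⟩, of_mem_arrowIdeal p e, arrow k f,
    TwoSidedIdeal.subset_span ⟨c, d, f, rfl⟩, ?_⟩
  rw [arrow, of_mul_of, pathMul_self]
  rfl

end PathAlgebra

/-! ### Basis, characters and radical of `T₂Q` -/

namespace T₂

variable (k : Type*) {V : Type*} [Field k] [Quiver V] [Fintype V]

/-- The projection of the path algebra onto `T₂Q`. -/
abbrev proj : PathAlgebra k V →ₐ[k] T₂ k V := RingCon.mkₐ k _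

variable {k}

theorem proj_surjective : Function.Surjective (proj k : PathAlgebra k V →ₐ[k] T₂ k V) :=
  RingCon.mkₐ_surjective _

theorem proj_eq_zero_iff {x : PathAlgebra k V} :
    proj k x = 0 ↔ x ∈ PathAlgebra.arrowIdealSq k V := by
  rw [TwoSidedIdeal.mem_iff]
  exact RingCon.eq _

theorem exists_lift (f : PathAlgebra k V →ₗ[k] k)
    (hf : ∀ x ∈ PathAlgebra.arrowIdealSq k V, f x = 0) :
    ∃ g : T₂ k V →ₗ[k] k, ∀ x, g (proj k x) = f x := by
  let π : PathAlgebra k V →ₗ[k] T₂ k V := (proj k).toLinearMap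
  have hker : LinearMap.ker π ≤ LinearMap.ker f := fun x hx => hf x (proj_eq_zero_iff.1 hx)
  refine ⟨(LinearMap.ker π).liftQ f hker ∘ₗ
    (π.quotKerEquivOfSurjective proj_surjective).symm.toLinearMap, fun x => ?_⟩
  have h : (π.quotKerEquivOfSurjective proj_surjective).symm (π x) = Submodule.Quotient.mk x := by
    rw [LinearEquiv.symm_apply_eq]
    rfl
  change (LinearMap.ker π).liftQ f hker ((π.quotKerEquivOfSurjective proj_surjective).symm (π x)) = _
  rw [h, Submodule.liftQ_apply]

variable (k) in
/-- The coefficient of a vertex. -/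
def vertexCoeff (v : V) : T₂ k V →ₗ[k] k :=
  (exists_lift (PathAlgebra.vertexCoeff k v)
    fun _ hx => (PathAlgebra.coeff_of_mem_arrowIdealSq hx).1 v).choose

variable (k) in
/-- The coefficient of an arrow. -/
def arrowCoeff {s t : V} (α : s ⟶ t) : T₂ k V →ₗ[k] k :=
  (exists_lift (PathAlgebra.arrowCoeff k α)
    fun _ hx => (PathAlgebra.coeff_of_mem_arrowIdealSq hx).2 s t α).choose

theorem vertexCoeff_proj (v : V) (x : PathAlgebra k V) :
    vertexCoeff k v (proj k x) = PathAlgebra.vertexCoeff k v x :=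
  (exists_lift (PathAlgebra.vertexCoeff k v)
    fun _ hx => (PathAlgebra.coeff_of_mem_arrowIdealSq hx).1 v).choose_spec x

theorem arrowCoeff_proj {s t : V} (α : s ⟶ t) (x : PathAlgebra k V) :
    arrowCoeff k α (proj k x) = PathAlgebra.arrowCoeff k α x :=
  (exists_lift (PathAlgebra.arrowCoeff k α)
    fun _ hx => (PathAlgebra.coeff_of_mem_arrowIdealSq hx).2 s t α).choose_spec x

theorem vertexCoeff_mul (v : V) (x y : T₂ k V) :
    vertexCoeff k v (x * y) = vertexCoeff k v x * vertexCoeff k v y := by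
  obtain ⟨x, rfl⟩ := proj_surjective x
  obtain ⟨y, rfl⟩ := proj_surjective y
  simp only [← map_mul, vertexCoeff_proj, PathAlgebra.vertexCoeff_mul]

theorem arrowCoeff_mul {s t : V} (α : s ⟶ t) (x y : T₂ k V) :
    arrowCoeff k α (x * y) =
      vertexCoeff k s x * arrowCoeff k α y + arrowCoeff k α x * vertexCoeff k t y := by
  obtain ⟨x, rfl⟩ := proj_surjective x
  obtain ⟨y, rfl⟩ := proj_surjective y
  simp only [← map_mul, vertexCoeff_proj, arrowCoeff_proj, PathAlgebra.arrowCoeff_mul]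

open Classical in
theorem vertexCoeff_vertex (v w : V) : vertexCoeff k v (vertex k w) = if w = v then 1 else 0 :=
  (vertexCoeff_proj v _).trans (PathAlgebra.vertexCoeff_of_nil v w)

@[simp] theorem vertexCoeff_vertex_self (v : V) : vertexCoeff k v (vertex k v) = 1 := by
  simp [vertexCoeff_vertex]

@[simp] theorem vertexCoeff_arrow (v : V) {s t : V} (α : s ⟶ t) :
    vertexCoeff k v (arrow k α) = 0 :=
  (vertexCoeff_proj v _).trans (PathAlgebra.vertexCoeff_of_cons v _ _)

@[simp] theorem arrowCoeff_vertex {s t : V} (α : s ⟶ t) (v : V) :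
    arrowCoeff k α (vertex k v) = 0 :=
  (arrowCoeff_proj α _).trans (PathAlgebra.arrowCoeff_of_nil α v)

@[simp] theorem arrowCoeff_arrow_self {s t : V} (α : s ⟶ t) :
    arrowCoeff k α (arrow k α) = 1 :=
  (arrowCoeff_proj α _).trans (PathAlgebra.coeff_of_self _)

theorem arrowCoeff_arrow_of_ne {α β : Σ s t : V, s ⟶ t} (h : β ≠ α) :
    arrowCoeff k α.2.2 (arrow k β.2.2) = 0 := by
  obtain ⟨s, t, α⟩ := α
  obtain ⟨s', t', β⟩ := β
  refine (arrowCoeff_proj α _).trans (PathAlgebra.coeff_of_ne fun h' => h ?_)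
  simp only [Sigma.mk.injEq] at h'
  obtain ⟨rfl, h'⟩ := h'
  simp only [heq_eq_eq, Sigma.mk.injEq] at h'
  obtain ⟨rfl, h'⟩ := h'
  simp only [heq_eq_eq, Hom.toPath, Path.cons.injEq, true_and] at h'
  rw [h']

theorem one_eq_sum_vertex : (1 : T₂ k V) = ∑ v, vertex k v := by
  rw [← map_one (proj k), PathAlgebra.one_def, map_sum]
  rfl

theorem vertex_mul_vertex_self (v : V) : vertex k v * vertex k v = vertex k v := by
  change proj k (PathAlgebra.of k _) * proj k (PathAlgebra.of k _) = proj k (PathAlgebra.of k _)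
  rw [← map_mul, PathAlgebra.of_mul_of, PathAlgebra.pathMul_self, Path.comp_nil]

theorem vertex_mul_vertex_of_ne {v w : V} (h : v ≠ w) : vertex k v * vertex k w = 0 := by
  change proj k (PathAlgebra.of k _) * proj k (PathAlgebra.of k _) = 0
  rw [← map_mul, PathAlgebra.of_mul_of, PathAlgebra.pathMul_of_ne _ _ h, map_zero]

theorem vertex_mul_arrow {s t : V} (α : s ⟶ t) : vertex k s * arrow k α = arrow k α := by
  change proj k (PathAlgebra.of k _) * proj k (PathAlgebra.of k _) = proj k (PathAlgebra.of k _)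
  rw [← map_mul, PathAlgebra.of_mul_of, PathAlgebra.pathMul_self, Path.nil_comp]

theorem arrow_mul_vertex {s t : V} (α : s ⟶ t) : arrow k α * vertex k t = arrow k α := by
  change proj k (PathAlgebra.of k _) * proj k (PathAlgebra.of k _) = proj k (PathAlgebra.of k _)
  rw [← map_mul, PathAlgebra.of_mul_of, PathAlgebra.pathMul_self, Path.comp_nil]

theorem vertex_mul_arrow_of_ne {v s t : V} (α : s ⟶ t) (h : v ≠ s) :
    vertex k v * arrow k α = 0 := by
  change proj k (PathAlgebra.of k _) * proj k (PathAlgebra.of k _) = 0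
  rw [← map_mul, PathAlgebra.of_mul_of, PathAlgebra.pathMul_of_ne _ _ h, map_zero]

theorem arrow_mul_vertex_of_ne {v s t : V} (α : s ⟶ t) (h : t ≠ v) :
    arrow k α * vertex k v = 0 := by
  change proj k (PathAlgebra.of k _) * proj k (PathAlgebra.of k _) = 0
  rw [← map_mul, PathAlgebra.of_mul_of, PathAlgebra.pathMul_of_ne _ _ h, map_zero]

variable (k V) in
/-- The family of the vertices and arrows. -/
def basisFun : V ⊕ (Σ s t : V, s ⟶ t) → T₂ k V :=
  Sum.elim (fun v => vertex k v) (fun α => arrow k α.2.2)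

variable (k V) in
/-- The coefficients with respect to the vertices and arrows. -/
def basisCoeff : V ⊕ (Σ s t : V, s ⟶ t) → T₂ k V →ₗ[k] k :=
  Sum.elim (fun v => vertexCoeff k v) (fun α => arrowCoeff k α.2.2)

open Classical in
theorem basisCoeff_basisFun (i j : V ⊕ (Σ s t : V, s ⟶ t)) :
    basisCoeff k V i (basisFun k V j) = if j = i then 1 else 0 := by
  rcases i with v | α <;> rcases j with w | β
  · simp [basisCoeff, basisFun, vertexCoeff_vertex]
  · simp [basisCoeff, basisFun]
  · simp [basisCoeff, basisFun]
  · by_cases h : β = α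
    · subst h
      simp [basisCoeff, basisFun]
    · simp [basisCoeff, basisFun, h, arrowCoeff_arrow_of_ne h]

/-- Paths of length at least two die in the quotient, which leaves vertices and arrows. -/
theorem span_basisFun : Submodule.span k (Set.range (basisFun k V)) = ⊤ := by
  refine eq_top_iff.2 fun x _ => ?_
  obtain ⟨x, rfl⟩ := proj_surjective x
  induction x using PathAlgebra.induction with
  | h0 => simp
  | hadd x y hx hy =>
    rw [map_add]
    exact add_mem (hx trivial) (hy trivial)
  | hof c p =>
    rw [map_smul]
    refine Submodule.smul_mem _ _ ?_
    obtain ⟨a, b, p⟩ := p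
    cases p with
    | nil => exact Submodule.subset_span ⟨Sum.inl a, rfl⟩
    | cons p e =>
      cases p with
      | nil => exact Submodule.subset_span ⟨Sum.inr ⟨a, b, e⟩, rfl⟩
      | cons p f =>
        rw [proj_eq_zero_iff.2 (PathAlgebra.of_mem_arrowIdealSq p f e)]
        exact zero_mem _

variable [∀ s t : V, Finite (s ⟶ t)]

theorem linearIndependent_basisFun : LinearIndependent k (basisFun k V) := by
  classical
  have := Fintype.ofFinite (Σ s t : V, s ⟶ t)
  refine Fintype.linearIndependent_iff.2 fun g hg i => ?_
  have h := congrArg (basisCoeff k V i) hg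
  simpa only [map_sum, map_zero, map_smul, basisCoeff_basisFun, smul_eq_mul, mul_ite, mul_one,
    mul_zero, Finset.sum_ite_eq', Finset.mem_univ, if_true] using h

variable (k V) in
/-- The basis of the vertices and arrows. -/
def basis : Module.Basis (V ⊕ (Σ s t : V, s ⟶ t)) k (T₂ k V) :=
  Module.Basis.mk linearIndependent_basisFun span_basisFun.ge

theorem basis_apply (i : V ⊕ (Σ s t : V, s ⟶ t)) : basis k V i = basisFun k V i :=
  Module.Basis.mk_apply ..

instance : FiniteDimensional k (T₂ k V) := Module.Finite.of_basis (basis k V)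

theorem finrank_eq :
    Module.finrank k (T₂ k V) = Nat.card V + Nat.card (Σ s t : V, s ⟶ t) := by
  rw [Module.finrank_eq_nat_card_basis (basis k V), Nat.card_sum]

/-- Linear maps on `T₂Q` are determined by the images of the vertices and arrows. -/
theorem linearMap_ext {M : Type*} [AddCommGroup M] [Module k M] {f g : T₂ k V →ₗ[k] M}
    (hv : ∀ v, f (vertex k v) = g (vertex k v))
    (ha : ∀ (s t : V) (α : s ⟶ t), f (arrow k α) = g (arrow k α)) : f = g := by
  refine (basis k V).ext fun i => ?_
  rw [basis_apply]
  rcases i with v | ⟨s, t, α⟩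
  · exact hv v
  · exact ha s t α

/-- Elements of `T₂Q` are determined by their coefficients. -/
theorem ext_coeff {x y : T₂ k V} (hv : ∀ v, vertexCoeff k v x = vertexCoeff k v y)
    (ha : ∀ (s t : V) (α : s ⟶ t), arrowCoeff k α x = arrowCoeff k α y) : x = y := by
  classical
  have h : ∀ i, basisCoeff k V i = (basis k V).coord i := fun i =>
    (basis k V).ext fun j => by
      rw [Module.Basis.coord_apply, Module.Basis.repr_self, basis_apply, basisCoeff_basisFun,
        Finsupp.single_apply]
  refine (basis k V).ext_elem fun i => ?_
  rw [← Module.Basis.coord_apply, ← Module.Basis.coord_apply, ← h]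
  rcases i with v | ⟨s, t, α⟩
  · exact hv v
  · exact ha s t α

/-- The character of a vertex. -/
def character (v : V) : T₂ k V →ₐ[k] k :=
  AlgHom.ofLinearMap (vertexCoeff k v) (by
    classical
    rw [one_eq_sum_vertex, map_sum]
    simp [vertexCoeff_vertex]) (vertexCoeff_mul v)

/-- Each character is a surjection onto the field `k`, so it kills the radical. Conversely, suppose
`x` has zero vertex coefficients and misses a maximal left ideal `I`: then `y * x + z = 1` with `z ∈
I`, and since `y * x` squares to zero, `(1 + y * x) * z = 1` lies in `I`, which is absurd. -/
theorem mem_radical_iff {x : T₂ k V} :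
    x ∈ radical k (T₂ k V) ↔ ∀ v, vertexCoeff k v x = 0 := by
  constructor
  · intro hx v
    have : RingHomSurjective (character (k := k) v).toRingHom :=
      ⟨fun c => ⟨algebraMap k _ c, (character v).commutes c⟩⟩
    have h := Ring.le_comap_jacobson (character (k := k) v).toRingHom hx
    have h0 : Ring.jacobson k = ⊥ :=
      le_bot_iff.1 (Ring.jacobson_le_of_isMaximal (⊥ : Ideal k))
    rw [h0] at h
    exact h
  · intro hx
    change x ∈ Ring.jacobson (T₂ k V)
    rw [Ring.jacobson_eq_sInf_isMaximal, Submodule.mem_sInf]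
    intro I hI
    by_contra hxI
    obtain ⟨y, z, hz, h⟩ := Ideal.IsMaximal.exists_inv hI hxI
    have hyx : ∀ v, vertexCoeff k v (y * x) = 0 := fun v => by
      rw [vertexCoeff_mul, hx, mul_zero]
    have hsq : y * x * (y * x) = 0 := by
      refine ext_coeff (fun v => ?_) (fun s t α => ?_)
      · rw [vertexCoeff_mul, hyx, zero_mul, map_zero]
      · rw [arrowCoeff_mul, hyx, hyx, zero_mul, mul_zero, add_zero, map_zero]
    have h1 : (1 + y * x) * z = 1 := by
      rw [← eq_sub_iff_add_eq'] at h
      rw [h, mul_sub, mul_one, add_mul, one_mul, hsq, add_zero, add_sub_cancel_right]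
    refine hI.ne_top ((Ideal.eq_top_iff_one I).2 ?_)
    rw [← h1]
    exact Ideal.mul_mem_left I _ hz

theorem mul_eq_zero_of_mem_radical {x y : T₂ k V} (hx : x ∈ radical k (T₂ k V))
    (hy : y ∈ radical k (T₂ k V)) : x * y = 0 := by
  rw [mem_radical_iff] at hx hy
  refine ext_coeff (fun v => ?_) (fun s t α => ?_)
  · rw [vertexCoeff_mul, hx, zero_mul, map_zero]
  · rw [arrowCoeff_mul, hx, hy, zero_mul, mul_zero, add_zero, map_zero]

theorem radical_sq : radical k (T₂ k V) ^ 2 = ⊥ := by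
  rw [pow_two, ← le_bot_iff, Submodule.mul_le]
  intro x hx y hy
  exact mul_eq_zero_of_mem_radical hx hy

theorem arrow_mem_radical {s t : V} (α : s ⟶ t) : arrow k α ∈ radical k (T₂ k V) :=
  mem_radical_iff.2 fun v => vertexCoeff_arrow v α

end T₂

/-! ## The linear forms which define subalgebras of `T₂Q` -/

namespace T₂

variable {k V : Type*} [Field k] [Quiver V] [Fintype V]

variable (k) in
/-- The linear form `a (s - t) + ∑ c α` on `T₂Q`, where `α` runs over the arrows from
`s` to `t`. -/
def pairForm (s t : V) : k × ((s ⟶ t) →₀ k) →ₗ[k] Module.Dual k (T₂ k V) :=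
  (LinearMap.toSpanSingleton k (Module.Dual k (T₂ k V))
    (vertexCoeff k s - vertexCoeff k t)).coprod
  (Finsupp.linearCombination k fun α : s ⟶ t => arrowCoeff k α)

theorem pairForm_apply (s t : V) (a : k) (c : (s ⟶ t) →₀ k) (x : T₂ k V) :
    pairForm k s t (a, c) x =
      a * (vertexCoeff k s x - vertexCoeff k t x) + c.sum fun α r => r * arrowCoeff k α x := by
  simp [pairForm, Finsupp.linearCombination_apply, Finsupp.sum, LinearMap.sum_apply]

theorem pairForm_vertex (s t : V) (a : k) (c : (s ⟶ t) →₀ k) (v : V) :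
    pairForm k s t (a, c) (vertex k v) =
      a * (vertexCoeff k s (vertex k v) - vertexCoeff k t (vertex k v)) := by
  simp [pairForm_apply]

theorem pairForm_arrow (s t : V) (a : k) (c : (s ⟶ t) →₀ k) (α : s ⟶ t) :
    pairForm k s t (a, c) (arrow k α) = c α := by
  rw [pairForm_apply, vertexCoeff_arrow, vertexCoeff_arrow, sub_zero, mul_zero, zero_add,
    Finsupp.sum_eq_single α, arrowCoeff_arrow_self, mul_one]
  · intro β _ hβ
    rw [arrowCoeff_arrow_of_ne (α := ⟨s, t, β⟩) (β := ⟨s, t, α⟩), mul_zero]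
    simpa using Ne.symm hβ
  · simp

theorem pairForm_arrow_of_ne (s t : V) (a : k) (c : (s ⟶ t) →₀ k) {u w : V} (α : u ⟶ w)
    (h : (u, w) ≠ (s, t)) : pairForm k s t (a, c) (arrow k α) = 0 := by
  rw [pairForm_apply, vertexCoeff_arrow, vertexCoeff_arrow, sub_zero, mul_zero, zero_add]
  refine Finset.sum_eq_zero fun β _ => ?_
  simp only
  rw [arrowCoeff_arrow_of_ne (α := ⟨s, t, β⟩) (β := ⟨u, w, α⟩), mul_zero]
  rintro h'
  simp only [Sigma.mk.injEq] at h'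
  obtain ⟨rfl, h'⟩ := h'
  simp only [heq_eq_eq, Sigma.mk.injEq] at h'
  exact h (by rw [h'.1])

/-- Both χ_s - χ_t and the coefficients of arrows from `s` to `t` satisfy this twisted Leibniz rule,
which is linear in the form. It makes the kernel closed under products. -/
theorem pairForm_mul (s t : V) (p : k × ((s ⟶ t) →₀ k)) (x y : T₂ k V) :
    pairForm k s t p (x * y) =
      vertexCoeff k s x * pairForm k s t p y + pairForm k s t p x * vertexCoeff k t y := by
  obtain ⟨a, c⟩ := p
  simp only [pairForm_apply, vertexCoeff_mul, arrowCoeff_mul, Finsupp.sum, mul_add, add_mul,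
    Finset.sum_add_distrib, Finset.mul_sum, Finset.sum_mul]
  have h1 : ∀ α : s ⟶ t, c α * (vertexCoeff k s x * arrowCoeff k α y) =
      vertexCoeff k s x * (c α * arrowCoeff k α y) := fun α => by ring
  have h2 : ∀ α : s ⟶ t, c α * (arrowCoeff k α x * vertexCoeff k t y) =
      c α * arrowCoeff k α x * vertexCoeff k t y := fun α => by ring
  simp only [h1, h2]
  ring

variable (k) in
/-- The space of the linear forms on `T₂Q` which vanish at `1`, at the vertices different from
`s` and `t`, and at the arrows which do not go from `s` to `t`. -/
def pairForms (s t : V) : Submodule k (Module.Dual k (T₂ k V)) where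
  carrier := {f | f 1 = 0 ∧ (∀ v, v ≠ s → v ≠ t → f (vertex k v) = 0) ∧
    ∀ (u w : V) (α : u ⟶ w), (u, w) ≠ (s, t) → f (arrow k α) = 0}
  zero_mem' := ⟨rfl, fun _ _ _ => rfl, fun _ _ _ _ => rfl⟩
  add_mem' := fun hf hg => ⟨by rw [LinearMap.add_apply, hf.1, hg.1, add_zero],
    fun v h h' => by rw [LinearMap.add_apply, hf.2.1 v h h', hg.2.1 v h h', add_zero],
    fun u w α h => by rw [LinearMap.add_apply, hf.2.2 u w α h, hg.2.2 u w α h, add_zero]⟩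
  smul_mem' := fun c f hf => ⟨by rw [LinearMap.smul_apply, hf.1, smul_zero],
    fun v h h' => by rw [LinearMap.smul_apply, hf.2.1 v h h', smul_zero],
    fun u w α h => by rw [LinearMap.smul_apply, hf.2.2 u w α h, smul_zero]⟩

theorem mem_pairForms {s t : V} {f : Module.Dual k (T₂ k V)} :
    f ∈ pairForms k s t ↔ f 1 = 0 ∧ (∀ v, v ≠ s → v ≠ t → f (vertex k v) = 0) ∧
      ∀ (u w : V) (α : u ⟶ w), (u, w) ≠ (s, t) → f (arrow k α) = 0 := Iff.rfl

theorem vertexCoeff_one [∀ s t : V, Finite (s ⟶ t)] (v : V) :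
    vertexCoeff k v (1 : T₂ k V) = 1 := map_one (character v)

theorem pairForm_one (s t : V) (p : k × ((s ⟶ t) →₀ k)) : pairForm k s t p 1 = 0 := by
  have h1 : ∀ v : V, vertexCoeff k v (1 : T₂ k V) = 1 := fun v => by
    classical
    rw [one_eq_sum_vertex, map_sum]
    simp [vertexCoeff_vertex]
  have h := pairForm_mul s t p 1 1
  rwa [mul_one, h1, h1, one_mul, mul_one, left_eq_add] at h

theorem pairForm_mem (s t : V) (p : k × ((s ⟶ t) →₀ k)) :
    pairForm k s t p ∈ pairForms k s t := by
  classical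
  obtain ⟨a, c⟩ := p
  refine ⟨pairForm_one s t _, fun v hs ht => ?_, fun u w α h => pairForm_arrow_of_ne s t a c α h⟩
  rw [pairForm_vertex, vertexCoeff_vertex, vertexCoeff_vertex, if_neg hs, if_neg ht, sub_zero,
    mul_zero]

theorem ker_pairForm {s t : V} (hst : s ≠ t) : LinearMap.ker (pairForm k s t) = ⊥ := by
  classical
  refine LinearMap.ker_eq_bot'.2 fun p hp => ?_
  obtain ⟨a, c⟩ := p
  refine Prod.ext ?_ (Finsupp.ext fun α => ?_)
  · have h := LinearMap.congr_fun hp (vertex k s)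
    rw [pairForm_vertex, vertexCoeff_vertex, vertexCoeff_vertex, if_pos rfl, if_neg hst, sub_zero,
      mul_one] at h
    exact h
  · have h := LinearMap.congr_fun hp (arrow k α)
    rwa [pairForm_arrow] at h

/-- For a loop the vertex part cancels and `a` plays no role; hence the components for loops have
dimension one less. -/
theorem pairForm_self (s : V) (a : k) (c : (s ⟶ s) →₀ k) :
    pairForm k s s (a, c) = pairForm k s s (0, c) := by
  refine LinearMap.ext fun x => ?_
  rw [pairForm_apply, pairForm_apply, sub_self, mul_zero, mul_zero]

variable [∀ s t : V, Finite (s ⟶ t)]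

theorem eq_pairForm {s t : V} {f : Module.Dual k (T₂ k V)} (hf : f ∈ pairForms k s t) :
    f = pairForm k s t
      (f (vertex k s), Finsupp.equivFunOnFinite.symm fun α => f (arrow k α)) := by
  classical
  obtain ⟨h1, hv, ha⟩ := mem_pairForms.1 hf
  refine linearMap_ext (fun v => ?_) fun u w α => ?_
  · rw [pairForm_vertex, vertexCoeff_vertex, vertexCoeff_vertex]
    rw [one_eq_sum_vertex, map_sum] at h1
    by_cases hst : s = t
    · subst hst
      rw [sub_self, mul_zero]
      by_cases hvs : v = s
      · subst hvs
        rwa [Finset.sum_eq_single v (fun w _ hw => hv w hw hw) (by simp)] at h1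
      · exact hv v hvs hvs
    -- Since 1 is the sum of the vertices and `f` kills the others, `f 1 = 0` makes the values at
    -- `s` and `t` opposite.
    · have h2 : f (vertex k s) + f (vertex k t) = 0 := by
        rw [← h1, ← Finset.sum_pair (f := fun v => f (vertex k v)) hst]
        refine Finset.sum_subset (Finset.subset_univ _) fun w _ hw => ?_
        simp only [Finset.mem_insert, Finset.mem_singleton, not_or] at hw
        exact hv w hw.1 hw.2
      by_cases hvs : v = s
      · subst hvs
        simp [hst]
      · by_cases hvt : v = t
        · subst hvt
          simp only [if_neg hvs, if_true]
          linear_combination h2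
        · rw [hv v hvs hvt, if_neg hvs, if_neg hvt, sub_zero, mul_zero]
  · by_cases h : (u, w) = (s, t)
    · obtain ⟨rfl, rfl⟩ := Prod.mk.inj h
      rw [pairForm_arrow]
      rfl
    · rw [pairForm_arrow_of_ne _ _ _ _ _ h, ha u w α h]

theorem range_pairForm (s t : V) : LinearMap.range (pairForm k s t) = pairForms k s t := by
  ext f
  constructor
  · rintro ⟨p, rfl⟩
    exact pairForm_mem s t p
  · exact fun hf => ⟨_, (eq_pairForm hf).symm⟩

theorem pairForms_mul {s t : V} {f : Module.Dual k (T₂ k V)} (hf : f ∈ pairForms k s t)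
    (x y : T₂ k V) : f (x * y) = vertexCoeff k s x * f y + f x * vertexCoeff k t y := by
  rw [eq_pairForm hf]
  exact pairForm_mul s t _ x y

theorem finrank_pairForms {s t : V} (hst : s ≠ t) :
    Module.finrank k (pairForms k s t) = Nat.card (s ⟶ t) + 1 := by
  have := Fintype.ofFinite (s ⟶ t)
  rw [← range_pairForm, LinearMap.finrank_range_of_inj (LinearMap.ker_eq_bot.1 (ker_pairForm hst)),
    Module.finrank_prod, Module.finrank_self, Module.finrank_finsupp_self, Nat.card_eq_fintype_card,
    add_comm]

theorem finrank_pairForms_self (s : V) :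
    Module.finrank k (pairForms k s s) = Nat.card (s ⟶ s) := by
  have := Fintype.ofFinite (s ⟶ s)
  have h1 : LinearMap.range (pairForm k s s ∘ₗ LinearMap.inr k k _) = pairForms k s s := by
    rw [← range_pairForm]
    refine le_antisymm (LinearMap.range_comp_le_range _ _) ?_
    rintro _ ⟨⟨a, c⟩, rfl⟩
    exact ⟨c, (pairForm_self s a c).symm⟩
  have h2 : Function.Injective (pairForm k s s ∘ₗ LinearMap.inr k k _) := by
    refine LinearMap.ker_eq_bot.1 (LinearMap.ker_eq_bot'.2 fun c hc => Finsupp.ext fun α => ?_)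
    have h := LinearMap.congr_fun hc (arrow k α)
    rwa [LinearMap.comp_apply, LinearMap.inr_apply, pairForm_arrow] at h
  rw [← h1, LinearMap.finrank_range_of_inj h2, Module.finrank_finsupp_self,
    Nat.card_eq_fintype_card]

theorem arrow_mul_arrow {s t u w : V} (α : s ⟶ t) (β : u ⟶ w) :
    arrow k α * arrow k β = 0 :=
  mul_eq_zero_of_mem_radical (arrow_mem_radical α) (arrow_mem_radical β)

/-- The kernel of a nonzero linear form which is a subalgebra is defined by a form attached to a
pair of vertices. -/
theorem exists_mem_pairForms {f : Module.Dual k (T₂ k V)} (hf : f ≠ 0) (h1 : f 1 = 0)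
    (hmul : ∀ x y, f x = 0 → f y = 0 → f (x * y) = 0) : ∃ s t, f ∈ pairForms k s t := by
  by_cases h : ∃ (u w : V) (α : u ⟶ w), f (arrow k α) ≠ 0
  · obtain ⟨u, w, α, hα⟩ := h
    -- These elements of the kernel are chosen so that in the products below every term but a
    -- multiple of `α` vanishes; as `f α ≠ 0`, its scalar factor must be zero.
    have key : ∀ v, f (f (arrow k α) • vertex k v - f (vertex k v) • arrow k α) = 0 := fun v => by
      simp only [map_sub, map_smul, smul_eq_mul]
      ring
    refine ⟨u, w, h1, fun v hu hw => ?_, fun u' w' β h => ?_⟩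
    · have h2 := hmul _ _ (key v) (key w)
      simp only [sub_mul, mul_sub, smul_mul_smul_comm, vertex_mul_vertex_of_ne hw,
        vertex_mul_arrow_of_ne α hu, arrow_mul_vertex, arrow_mul_arrow, map_neg, map_smul,
        smul_zero, smul_eq_mul, sub_zero, zero_sub, neg_eq_zero, mul_eq_zero, hα,
        or_false] at h2
      exact h2
    -- If the targets differ, multiplying on the right by the kernel element for `w` kills `β` but
    -- keeps `α`; if the sources differ, the element for `u` does so on the left.
    · have key' : f (f (arrow k β) • arrow k α - f (arrow k α) • arrow k β) = 0 := by
        simp only [map_sub, map_smul, smul_eq_mul]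
        ring
      by_cases hu : u = u'
      · have hw : w' ≠ w := fun hw => h (by rw [hu, hw])
        have h2 := hmul _ _ key' (key w)
        simp only [sub_mul, mul_sub, smul_mul_smul_comm, arrow_mul_vertex_of_ne β hw,
          arrow_mul_vertex, arrow_mul_arrow, map_smul, smul_zero, smul_eq_mul,
          sub_zero, mul_eq_zero, hα, or_false] at h2
        exact h2
      · have h2 := hmul _ _ (key u) key'
        simp only [sub_mul, mul_sub, smul_mul_smul_comm, vertex_mul_arrow_of_ne β hu,
          vertex_mul_arrow, arrow_mul_arrow, map_smul, smul_zero, smul_eq_mul,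
          sub_zero, mul_eq_zero, hα, or_false, false_or] at h2
        exact h2
  · push Not at h
    obtain ⟨s, hs⟩ : ∃ s, f (vertex k s) ≠ 0 := by
      by_contra! hv
      exact hf (linearMap_ext hv h)
    -- Without arrows, `f 1 = 0` forces a second vertex with nonzero value. For a third vertex `v`,
    -- the product `(f(s)t - f(t)s)(f(t)v - f(v)t)` is `-f(s)f(v)t`, so `f(v) = 0`.
    obtain ⟨t, hts, ht⟩ : ∃ t, t ≠ s ∧ f (vertex k t) ≠ 0 := by
      by_contra! hv
      rw [one_eq_sum_vertex, map_sum, Finset.sum_eq_single s (fun w _ hw => hv w hw) (by simp)] at h1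
      exact hs h1
    refine ⟨s, t, h1, fun v hvs hvt => ?_, fun u w α _ => h u w α⟩
    have key : ∀ u w, f (f (vertex k u) • vertex k w - f (vertex k w) • vertex k u) = 0 :=
      fun u w => by
        simp only [map_sub, map_smul, smul_eq_mul]
        ring
    have h2 := hmul _ _ (key s t) (key t v)
    simp only [sub_mul, mul_sub, smul_mul_smul_comm, vertex_mul_vertex_self,
      vertex_mul_vertex_of_ne hvt.symm, vertex_mul_vertex_of_ne hvs.symm,
      vertex_mul_vertex_of_ne hts.symm, map_neg, map_smul, smul_zero, smul_eq_mul,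
      sub_zero, zero_sub, neg_eq_zero, mul_eq_zero, hs, ht, false_or, or_false] at h2
    exact h2

/-! ## The subalgebras on the list as kernels -/

theorem sepSub_eq_ker {s t : V} (hst : s ≠ t) :
    sepSub k s t = LinearMap.ker (pairForm k s t (1, 0)) := by
  classical
  have happ : ∀ x, pairForm k s t (1, 0) x = vertexCoeff k s x - vertexCoeff k t x := fun x => by
    simp [pairForm_apply]
  refine le_antisymm (sup_le (sup_le ?_ ?_) fun x hx => ?_) fun x hx => ?_
  · rw [Submodule.span_singleton_le_iff_mem, LinearMap.mem_ker, happ]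
    simp [vertexCoeff_vertex, hst, hst.symm]
  · rw [Submodule.span_le]
    rintro _ ⟨w, hs, ht, rfl⟩
    simp [happ, vertexCoeff_vertex, hs, ht]
  · rw [mem_radical_iff] at hx
    rw [LinearMap.mem_ker, happ, hx, hx, sub_zero]
  · rw [LinearMap.mem_ker, happ, sub_eq_zero] at hx
    -- `y` is the vertex part of `x`, which uses `s + t` because the coefficients at `s` and `t`
    -- agree; the remainder `x - y` is radical.
    let y : T₂ k V := vertexCoeff k s x • (vertex k s + vertex k t) +
      ∑ w ∈ Finset.univ \ {s, t}, vertexCoeff k w x • vertex k w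
    have hy : x - y ∈ radical k (T₂ k V) := by
      refine mem_radical_iff.2 fun v => ?_
      have hsum : vertexCoeff k v (∑ w ∈ Finset.univ \ {s, t}, vertexCoeff k w x • vertex k w) =
          if v ∈ Finset.univ \ {s, t} then vertexCoeff k v x else 0 := by
        simp only [map_sum, map_smul, vertexCoeff_vertex, smul_eq_mul, mul_ite, mul_one, mul_zero,
          Finset.sum_ite_eq']
      simp only [y, map_sub, map_add, map_smul, hsum, vertexCoeff_vertex]
      by_cases hvs : v = s
      · subst hvs
        simp [hst.symm]
      · by_cases hvt : v = t
        · subst hvt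
          simp [hst, hx]
        · simp [hvs, hvt, Ne.symm hvs, Ne.symm hvt]
    rw [← sub_add_cancel x y, add_comm]
    refine Submodule.add_mem_sup (Submodule.add_mem_sup ?_ ?_) hy
    · exact Submodule.smul_mem _ _ (Submodule.mem_span_singleton_self _)
    · refine sum_mem fun w hw => Submodule.smul_mem _ _ (Submodule.subset_span ⟨w, ?_, ?_, rfl⟩)
      · rintro rfl
        simp at hw
      · rintro rfl
        simp at hw

/-- The left side lies in the kernel, and together with one arrow `α₀` where `c α₀ ≠ 0` it spans
everything. The form is injective on the line of `α₀`, so the kernel cannot be larger. -/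
theorem splitSub_eq_ker {s t : V} {c : (s ⟶ t) →₀ k} (hc : c ≠ 0) :
    splitSub k s t (arrowSpan k s t ⊓ LinearMap.ker (pairForm k s t (0, c))) =
      LinearMap.ker (pairForm k s t (0, c)) := by
  set g := pairForm k s t (0, c)
  set S := splitSub k s t (arrowSpan k s t ⊓ LinearMap.ker g) with hS
  have hvS : ∀ v, vertex k v ∈ S := fun v =>
    Submodule.mem_sup_left (Submodule.mem_sup_left (Submodule.mem_sup_left
      (Submodule.subset_span ⟨v, rfl⟩)))
  have hUS : arrowSpan k s t ⊓ LinearMap.ker g ≤ S := fun x hx =>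
    Submodule.mem_sup_left (Submodule.mem_sup_left (Submodule.mem_sup_right hx))
  have haS : ∀ (u w : V) (α : u ⟶ w), (u, w) ≠ (s, t) → arrow k α ∈ S := fun u w α h =>
    Submodule.mem_sup_left (Submodule.mem_sup_right (Submodule.mem_iSup_of_mem u
      (Submodule.mem_iSup_of_mem w (Submodule.mem_iSup_of_mem h
        (Submodule.subset_span ⟨α, rfl⟩)))))
  have hle : S ≤ LinearMap.ker g := by
    rw [hS, splitSub, radical_sq]
    refine sup_le (sup_le (sup_le ?_ inf_le_right) ?_) bot_le
    · rw [Submodule.span_le]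
      rintro _ ⟨v, rfl⟩
      exact (pairForm_vertex s t 0 c v).trans (zero_mul _)
    · refine iSup_le fun u => iSup_le fun w => iSup_le fun h => ?_
      rw [arrowSpan, Submodule.span_le]
      rintro _ ⟨α, rfl⟩
      exact pairForm_arrow_of_ne s t 0 c α h
  refine le_antisymm hle fun x hx => ?_
  obtain ⟨α₀, hα₀⟩ := Finsupp.ne_iff.1 hc
  rw [Finsupp.zero_apply] at hα₀
  have htop : S ⊔ Submodule.span k {arrow k α₀} = ⊤ := by
    rw [eq_top_iff, ← span_basisFun, Submodule.span_le]
    rintro _ ⟨v | ⟨u, w, α⟩, rfl⟩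
    · exact Submodule.mem_sup_left (hvS v)
    · by_cases h : (u, w) = (s, t)
      · obtain ⟨rfl, rfl⟩ := Prod.mk.inj h
        change arrow k α ∈ _
        rw [← sub_add_cancel (arrow k α) ((c α / c α₀) • arrow k α₀)]
        refine Submodule.add_mem_sup (hUS ⟨?_, ?_⟩)
          (Submodule.smul_mem _ _ (Submodule.mem_span_singleton_self _))
        · exact sub_mem (Submodule.subset_span ⟨α, rfl⟩)
            (Submodule.smul_mem _ _ (Submodule.subset_span ⟨α₀, rfl⟩))
        · rw [SetLike.mem_coe, LinearMap.mem_ker, map_sub, map_smul, pairForm_arrow,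
            pairForm_arrow, smul_eq_mul, div_mul_cancel₀ _ hα₀, sub_self]
      · exact Submodule.mem_sup_left (haS u w α h)
  obtain ⟨y, hy, z, hz, rfl⟩ := Submodule.mem_sup.1 (htop ▸ Submodule.mem_top (x := x))
  obtain ⟨r, rfl⟩ := Submodule.mem_span_singleton.1 hz
  have h1 := LinearMap.mem_ker.1 hx
  rw [map_add, LinearMap.mem_ker.1 (hle hy), zero_add, map_smul, pairForm_arrow, smul_eq_mul,
    mul_eq_zero, or_iff_left hα₀] at h1
  rwa [h1, zero_smul, add_zero]

/-- Take a form that vanishes on `U` but not on the whole arrow span; `c` records its values on the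
arrows, and the codimension turns the inclusion into equality. -/
theorem exists_pairForm_of_hyperplane {s t : V} {U : Submodule k (T₂ k V)}
    (hU : U ≤ arrowSpan k s t)
    (hrank : Module.finrank k U + 1 = Module.finrank k (arrowSpan k s t)) :
    ∃ c : (s ⟶ t) →₀ k, c ≠ 0 ∧
      U = arrowSpan k s t ⊓ LinearMap.ker (pairForm k s t (0, c)) := by
  have hne : ¬ arrowSpan k s t ≤ U := fun h => by
    rw [le_antisymm hU h] at hrank
    lia
  obtain ⟨x, hx, hxU⟩ := SetLike.not_le_iff_exists.1 hne
  obtain ⟨f, hfx, hf⟩ := Submodule.exists_le_ker_of_notMem hxU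
  let c : (s ⟶ t) →₀ k := Finsupp.equivFunOnFinite.symm fun α => f (arrow k α)
  have hfg : ∀ y ∈ arrowSpan k s t, pairForm k s t (0, c) y = f y := by
    intro y hy
    have : arrowSpan k s t ≤ LinearMap.ker (pairForm k s t (0, c) - f) := by
      rw [arrowSpan, Submodule.span_le]
      rintro _ ⟨α, rfl⟩
      rw [SetLike.mem_coe, LinearMap.mem_ker, LinearMap.sub_apply, pairForm_arrow]
      exact sub_self _
    exact sub_eq_zero.1 (this hy)
  have hUle : U ≤ arrowSpan k s t ⊓ LinearMap.ker (pairForm k s t (0, c)) := fun y hy =>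
    ⟨hU hy, (hfg y (hU hy)).trans (hf hy)⟩
  have hlt : arrowSpan k s t ⊓ LinearMap.ker (pairForm k s t (0, c)) < arrowSpan k s t := by
    refine lt_of_le_not_ge inf_le_left fun h => hfx ?_
    rw [← hfg x hx]
    exact (h hx).2
  refine ⟨c, fun h => hfx ?_, Submodule.eq_of_le_of_finrank_le hUle ?_⟩
  · rw [← hfg x hx, h, show ((0 : k), (0 : (s ⟶ t) →₀ k)) = 0 from rfl, map_zero,
      LinearMap.zero_apply]
  · have := Submodule.finrank_lt_finrank_of_lt hlt
    rw [← hrank] at this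
    exact Nat.le_of_lt_succ this

theorem finrank_arrowSpan_inf_ker {s t : V} {c : (s ⟶ t) →₀ k} (hc : c ≠ 0) :
    Module.finrank k ↥(arrowSpan k s t ⊓ LinearMap.ker (pairForm k s t (0, c))) + 1 =
      Module.finrank k (arrowSpan k s t) := by
  obtain ⟨α₀, hα₀⟩ := Finsupp.ne_iff.1 hc
  rw [Finsupp.zero_apply] at hα₀
  let g : arrowSpan k s t →ₗ[k] k := (pairForm k s t (0, c)).domRestrict (arrowSpan k s t)
  have hg : g ≠ 0 := fun h => hα₀ (by
    have h1 := LinearMap.congr_fun h ⟨arrow k α₀, Submodule.subset_span ⟨α₀, rfl⟩⟩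
    rwa [LinearMap.domRestrict_apply, pairForm_arrow] at h1)
  have h1 := g.finrank_range_add_finrank_ker
  rw [LinearMap.range_eq_top.2 (LinearMap.surjective hg), finrank_top, Module.finrank_self] at h1
  rw [← Submodule.map_comap_subtype, Submodule.finrank_map_subtype_eq, ← h1, add_comm]
  rfl

/-- Conjugation by a unit. -/
def conj (u : (T₂ k V)ˣ) : T₂ k V ≃ₐ[k] T₂ k V :=
  AlgEquiv.ofLinearEquiv
    { toFun := fun b => u * b * (u⁻¹ : (T₂ k V)ˣ)
      invFun := fun b => (u⁻¹ : (T₂ k V)ˣ) * b * u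
      map_add' := fun x y => by rw [mul_add, add_mul]
      map_smul' := fun c x => by rw [mul_smul_comm, smul_mul_assoc, RingHom.id_apply]
      left_inv := fun b => by simp [mul_assoc]
      right_inv := fun b => by simp [mul_assoc] }
    (by simp) (fun x y => by simp [mul_assoc])

/-- As `x * x = 0`, the inverse of `1 + x` is `1 - x`. By the twisted Leibniz rule, pulling `g` back
along the inverse conjugation adds `g x` times χ_s - χ_t and leaves `c` unchanged. -/
theorem map_ker_pairForm {s t : V} {c : (s ⟶ t) →₀ k} {x : T₂ k V}
    (hx : x ∈ radical k (T₂ k V)) {u : (T₂ k V)ˣ} (hu : (u : T₂ k V) = 1 + x)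
    {φ : T₂ k V ≃ₐ[k] T₂ k V} (hφ : ∀ b, φ b = u * b * (u⁻¹ : (T₂ k V)ˣ)) :
    (LinearMap.ker (pairForm k s t (0, c))).map φ.toLinearMap =
      LinearMap.ker (pairForm k s t (pairForm k s t (0, c) x, c)) := by
  set g := pairForm k s t (0, c) with hg
  have hu' : ((u⁻¹ : (T₂ k V)ˣ) : T₂ k V) = 1 - x := by
    refine Units.inv_eq_of_mul_eq_one_right ?_
    rw [hu, add_mul, one_mul, mul_sub, mul_one, mul_eq_zero_of_mem_radical hx hx, sub_zero,
      sub_add_cancel]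
  have hform : ∀ b, pairForm k s t (g x, c) b = g ((u⁻¹ : (T₂ k V)ˣ) * b * u) := by
    intro b
    have hxv := mem_radical_iff.1 hx
    have hg1 : g 1 = 0 := pairForm_one s t _
    have e1 : pairForm k s t (g x, c) b = g x * (vertexCoeff k s b - vertexCoeff k t b) + g b := by
      rw [hg, pairForm_apply, pairForm_apply _ _ 0 c b, zero_mul, zero_add]
    rw [e1, hu', hu, mul_assoc, hg, pairForm_mul, pairForm_mul, ← hg]
    simp only [map_sub, map_add, vertexCoeff_mul, vertexCoeff_one, hxv, hg1]
    ring
  ext b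
  rw [Submodule.mem_map, LinearMap.mem_ker, hform]
  constructor
  · rintro ⟨a, ha, rfl⟩
    rw [AlgEquiv.toLinearMap_apply, hφ]
    simpa [mul_assoc] using ha
  · intro h
    refine ⟨(u⁻¹ : (T₂ k V)ˣ) * b * u, h, ?_⟩
    rw [AlgEquiv.toLinearMap_apply, hφ]
    simp [mul_assoc]

/-- Conjugation moves the vertex coefficient from 0 to `g x`. Since `c ≠ 0`, the radical element `x
= (a / c α₀) • α₀` realises any prescribed `a`. -/
theorem mem_splitFamily_iff {s t : V} {A : Submodule k (T₂ k V)} :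
    A ∈ splitFamily k s t ↔
      ∃ (a : k) (c : (s ⟶ t) →₀ k), c ≠ 0 ∧ A = LinearMap.ker (pairForm k s t (a, c)) := by
  constructor
  · rintro ⟨U, hU, hrank, φ, ⟨x, hx, u, hu, hφ⟩, rfl⟩
    obtain ⟨c, hc, rfl⟩ := exists_pairForm_of_hyperplane hU hrank
    refine ⟨pairForm k s t (0, c) x, c, hc, ?_⟩
    rw [splitSub_eq_ker hc, map_ker_pairForm hx hu hφ]
  · rintro ⟨a, c, hc, rfl⟩
    refine ⟨_, inf_le_left, finrank_arrowSpan_inf_ker hc, ?_⟩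
    obtain ⟨α₀, hα₀⟩ := Finsupp.ne_iff.1 hc
    rw [Finsupp.zero_apply] at hα₀
    let x : T₂ k V := (a / c α₀) • arrow k α₀
    have hx : x ∈ radical k (T₂ k V) := Submodule.smul_mem _ _ (arrow_mem_radical α₀)
    have hxx : x * x = 0 := mul_eq_zero_of_mem_radical hx hx
    let u : (T₂ k V)ˣ := ⟨1 + x, 1 - x, by noncomm_ring; simp [hxx], by noncomm_ring; simp [hxx]⟩
    refine ⟨conj u, ⟨x, hx, u, rfl, fun b => rfl⟩, ?_⟩
    rw [splitSub_eq_ker hc, map_ker_pairForm hx (u := u) rfl (fun b => rfl)]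
    congr 3
    simp only [x, map_smul, pairForm_arrow, smul_eq_mul, div_mul_cancel₀ _ hα₀]

/-- The kernels of the nonzero forms in a space of linear forms. -/
def kernels {W : Type*} [AddCommGroup W] [Module k W] (L : Submodule k (Module.Dual k W)) :
    Set (Submodule k W) :=
  {A | ∃ f ∈ L, f ≠ 0 ∧ A = LinearMap.ker f}

theorem kernels_pairForms {s t : V} (hst : s ≠ t) :
    kernels (pairForms k s t) = splitFamily k s t ∪ {sepSub k s t} := by
  ext A
  rw [Set.mem_union, mem_splitFamily_iff, Set.mem_singleton_iff, sepSub_eq_ker hst]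
  constructor
  · rintro ⟨f, hf, hf0, rfl⟩
    rw [← range_pairForm] at hf
    obtain ⟨⟨a, c⟩, rfl⟩ := hf
    by_cases hc : c = 0
    · subst hc
      right
      have ha : a ≠ 0 := by
        rintro rfl
        exact hf0 (map_zero (pairForm k s t))
      rw [show ((a, 0) : k × ((s ⟶ t) →₀ k)) = a • (1, 0) by simp, map_smul,
        LinearMap.ker_smul _ _ ha]
    · exact Or.inl ⟨a, c, hc, rfl⟩
  · have h0 : ∀ p, p ≠ 0 → pairForm k s t p ≠ 0 := fun p hp h =>
      hp (LinearMap.ker_eq_bot'.1 (ker_pairForm hst) p h)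
    rintro (⟨a, c, hc, rfl⟩ | rfl)
    · exact ⟨_, pairForm_mem s t _, h0 _ fun h => hc (congrArg Prod.snd h), rfl⟩
    · exact ⟨_, pairForm_mem s t _, h0 _ fun h => one_ne_zero (congrArg Prod.fst h), rfl⟩

theorem kernels_pairForms_self (s : V) : kernels (pairForms k s s) = splitFamily k s s := by
  ext A
  rw [mem_splitFamily_iff]
  constructor
  · rintro ⟨f, hf, hf0, rfl⟩
    rw [← range_pairForm] at hf
    obtain ⟨⟨a, c⟩, rfl⟩ := hf
    refine ⟨a, c, ?_, rfl⟩
    rintro rfl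
    rw [pairForm_self] at hf0
    exact hf0 (map_zero (pairForm k s s))
  · rintro ⟨a, c, hc, rfl⟩
    refine ⟨_, pairForm_mem s s _, fun h => hc (Finsupp.ext fun α => ?_), rfl⟩
    have h1 := LinearMap.congr_fun h (arrow k α)
    rwa [pairForm_arrow] at h1

theorem kernels_pairForms_of_isEmpty {s t : V} (hst : s ≠ t) [IsEmpty (s ⟶ t)] :
    kernels (pairForms k s t) = {sepSub k s t} := by
  rw [kernels_pairForms hst, Set.union_eq_right]
  intro A hA
  obtain ⟨a, c, hc, -⟩ := mem_splitFamily_iff.1 hA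
  exact (hc (Subsingleton.elim _ _)).elim

end T₂

/-! ## Irreducible components and dimension -/

/-- A chain of irreducible closed sets lies inside any component containing its largest member, and
stays a chain there. -/
theorem topologicalKrullDim_le_of_irreducibleComponents {X : Type*} [TopologicalSpace X]
    {d : WithBot ℕ∞} (h : ∀ Z ∈ irreducibleComponents X, topologicalKrullDim Z ≤ d) :
    topologicalKrullDim X ≤ d := by
  refine iSup_le fun s => ?_
  obtain ⟨Z, hZ, hsZ⟩ :=
    exists_mem_irreducibleComponents_subset_of_isIrreducible _ s.last.isIrreducible
  refine le_trans ?_ (h Z hZ)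
  have hle : ∀ i, (s i : Set X) ⊆ Z := fun i => subset_trans (s.monotone (Fin.le_last i)) hsZ
  have hirr : ∀ i, IsIrreducible (Subtype.val ⁻¹' (s i : Set X) : Set Z) := by
    intro i
    obtain ⟨x, hx⟩ := (s i).isIrreducible.nonempty
    refine ⟨⟨⟨x, hle i hx⟩, hx⟩, ?_⟩
    rintro _ _ ⟨u, hu, rfl⟩ ⟨v, hv, rfl⟩ ⟨y, hy, hyu⟩ ⟨z, hz, hzv⟩
    obtain ⟨w, hw, hwuv⟩ := (s i).isIrreducible.isPreirreducible u v hu hv ⟨y.1, hy, hyu⟩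
      ⟨z.1, hz, hzv⟩
    exact ⟨⟨w, hle i hw⟩, hw, hwuv⟩
  let s' : LTSeries (TopologicalSpace.IrreducibleCloseds Z) := LTSeries.mk s.length
    (fun i => ⟨Subtype.val ⁻¹' (s i : Set X), hirr i,
      (s i).isClosed.preimage continuous_subtype_val⟩) (by
      intro i j hij
      have hlt := s.strictMono hij
      refine lt_of_le_not_ge (fun x hx => hlt.le hx) fun hge => hlt.not_ge fun x hx => ?_
      exact hge (show (⟨x, hle j hx⟩ : Z) ∈ Subtype.val ⁻¹' (s j : Set X) from hx))
  exact Order.LTSeries.length_le_krullDim s'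

theorem IsIrreducible.exists_subset_of_subset_iUnion {X ι : Type*} [TopologicalSpace X] [Finite ι]
    {s : Set X} (hs : IsIrreducible s) {Z : ι → Set X} (hZ : ∀ i, IsClosed (Z i))
    (h : s ⊆ ⋃ i, Z i) : ∃ i, s ⊆ Z i := by
  classical
  have := Fintype.ofFinite ι
  obtain ⟨z, hz, hsz⟩ := isIrreducible_iff_sUnion_isClosed.1 hs (Finset.univ.image Z)
    (by simpa using hZ) (by simpa using h)
  obtain ⟨i, -, rfl⟩ := Finset.mem_image.1 hz
  exact ⟨i, hsz⟩

namespace ProjSpace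

variable {k : Type*} {W : Type*} [Field k] [AddCommGroup W] [Module k W]

theorem isomorphic_of_finrank_eq {L : Submodule k W} {d : ℕ} (hL : Module.finrank k L = d + 1) :
    Isomorphic k (linearSubspace L) (ProjSpace k (Fin (d + 1) → k)) := by
  have : Module.Finite k L := Module.finite_of_finrank_pos (by lia)
  let e : (Fin (d + 1) → k) ≃ₗ[k] L := LinearEquiv.ofFinrankEq _ _ (by simp [hL])
  let j : (Fin (d + 1) → k) →ₗ[k] W := L.subtype ∘ₗ e.toLinearMap
  have hj : LinearMap.ker j = ⊥ := LinearMap.ker_eq_bot.2 (Subtype.val_injective.comp e.injective)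
  have hr : LinearMap.range j = L := by
    rw [LinearMap.range_comp, LinearEquiv.range, Submodule.map_top, Submodule.range_subtype]
  have h := isomorphic_linearSubspace j hj
  rwa [hr] at h

end ProjSpace

theorem Gr.toSubmodule_eq_ker {k W : Type*} {m : ℕ} [Field k] [AddCommGroup W] [Module k W]
    [FiniteDimensional k W] (hW : Module.finrank k W = m + 1) {A : Gr k m W}
    {F : Frame k 1 (Module.Dual k W)} (h : Gr.hyperplaneEquiv hW A = Gr.ofFrame F) :
    A.toSubmodule = LinearMap.ker F.vec := by
  rw [← Equiv.eq_symm_apply] at h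
  rw [h]
  change (Gr.ofFrame F).toSubmodule.dualCoannihilator = _
  rw [Frame.toSubmodule_ofFrame]
  ext x
  rw [Submodule.mem_dualCoannihilator, LinearMap.mem_ker]
  refine ⟨fun h => h _ (Submodule.mem_span_singleton_self _), fun h φ hφ => ?_⟩
  obtain ⟨c, rfl⟩ := Submodule.mem_span_singleton.1 hφ
  rw [LinearMap.smul_apply, h, smul_zero]

/-! ## The variety `msa(Q)` -/

namespace T₂

variable {k V : Type*} [Field k] [Quiver V] [Fintype V]

/-- Without arrows from `s` to `t`, only multiples of χ_s - χ_t remain, and these do not see the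
order of the pair. -/
theorem pairForms_le_of_isEmpty {s t : V} [IsEmpty (s ⟶ t)] :
    pairForms k s t ≤ pairForms k t s := by
  refine fun f hf => ⟨hf.1, fun v h h' => hf.2.1 v h' h, fun u w α _ => hf.2.2 u w α ?_⟩
  intro h'
  obtain ⟨rfl, rfl⟩ := Prod.mk.inj h'
  exact isEmptyElim α

/-- The coefficient of `α` alone, as an element of the smaller space, determines both end points. -/
theorem eq_of_pairForms_le_of_hom {s t s' t' : V} (α : s ⟶ t)
    (h : pairForms k s t ≤ pairForms k s' t') : s = s' ∧ t = t' := by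
  have h1 := h (pairForm_mem s t (0, Finsupp.single α 1))
  by_contra h2
  have h3 := h1.2.2 s t α fun h => h2 (Prod.mk.inj h)
  rw [pairForm_arrow, Finsupp.single_eq_same] at h3
  exact one_ne_zero h3

/-- Tested on χ_s - χ_t, which is nonzero at both vertices. -/
theorem mem_pair_of_pairForms_le {s t s' t' : V} (hst : s ≠ t)
    (h : pairForms k s t ≤ pairForms k s' t') : (s = s' ∨ s = t') ∧ (t = s' ∨ t = t') := by
  classical
  have h1 := h (pairForm_mem s t (1, 0))
  constructor
  · by_contra! h2
    have h3 := h1.2.1 s h2.1 h2.2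
    simp [pairForm_vertex, vertexCoeff_vertex, hst] at h3
  · by_contra! h2
    have h3 := h1.2.1 t h2.1 h2.2
    simp [pairForm_vertex, vertexCoeff_vertex, hst.symm] at h3

theorem pairForms_le_of_forall {s t : V} (hV : ∀ v, v = s ∨ v = t)
    (hQ : ∀ u w : V, (u ⟶ w) → u = s ∧ w = t) (u w : V) :
    pairForms k u w ≤ pairForms k s t := by
  refine fun f hf => ⟨hf.1, fun v hs ht => ((hV v).elim hs ht).elim, fun u' w' α h => ?_⟩
  obtain ⟨rfl, rfl⟩ := hQ u' w' α
  exact (h rfl).elim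

variable (k) in
/-- The pairs of vertices whose spaces of forms are maximal. -/
def IsMaximalPair (s t : V) : Prop :=
  pairForms k s t ≠ ⊥ ∧ (Nonempty (s ⟶ t) ∨ IsEmpty (t ⟶ s))

theorem exists_isMaximalPair {s t : V} (h : pairForms k s t ≠ ⊥) :
    ∃ s' t', IsMaximalPair k s' t' ∧ pairForms k s t ≤ pairForms k s' t' := by
  by_cases h' : Nonempty (s ⟶ t) ∨ IsEmpty (t ⟶ s)
  · exact ⟨s, t, ⟨h, h'⟩, le_rfl⟩
  · rw [not_or, not_nonempty_iff, not_isEmpty_iff] at h'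
    have := h'.1
    have hle : pairForms k s t ≤ pairForms k t s := pairForms_le_of_isEmpty
    exact ⟨t, s, ⟨fun h0 => h (le_bot_iff.1 (h0 ▸ hle)), Or.inl h'.2⟩, hle⟩

variable [∀ s t : V, Finite (s ⟶ t)]

theorem finrank_eq_succ [Nonempty V] :
    Module.finrank k (T₂ k V) = Module.finrank k (T₂ k V) - 1 + 1 := by
  have h := finrank_eq (k := k) (V := V)
  have h1 : 0 < Nat.card V := Nat.card_pos
  lia

theorem pairForms_ne_bot {s t : V} (hst : s ≠ t) : pairForms k s t ≠ ⊥ := by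
  intro h
  have h1 := finrank_pairForms (k := k) hst
  rw [h, finrank_bot] at h1
  lia

theorem pairForms_self_ne_bot_iff {s : V} : pairForms k s s ≠ ⊥ ↔ Nonempty (s ⟶ s) := by
  rw [Ne, ← Submodule.finrank_eq_zero (R := k), finrank_pairForms_self]
  exact Nat.card_ne_zero.trans (and_iff_left inferInstance)

/-- Maximality concerns the space and not the pair: two vertices without arrows between them give
the same space in both orders. -/
theorem IsMaximalPair.pairForms_le {s t s' t' : V} (h : IsMaximalPair k s t)
    (hle : pairForms k s t ≤ pairForms k s' t') : pairForms k s' t' ≤ pairForms k s t := by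
  rcases isEmpty_or_nonempty (s ⟶ t) with he | ⟨⟨α⟩⟩
  · have he' : IsEmpty (t ⟶ s) := h.2.resolve_left (not_nonempty_iff.2 he)
    have hst : s ≠ t := by
      rintro rfl
      exact not_nonempty_iff.2 he (pairForms_self_ne_bot_iff.1 h.1)
    obtain ⟨rfl | rfl, rfl | rfl⟩ := mem_pair_of_pairForms_le hst hle
    · exact (hst rfl).elim
    · exact le_rfl
    · exact pairForms_le_of_isEmpty
    · exact (hst rfl).elim
  · obtain ⟨rfl, rfl⟩ := eq_of_pairForms_le_of_hom α hle
    exact le_rfl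

/-- Translates the three kinds of listed sets into linear algebra; `d` is a projective dimension,
one less than the dimension of the space of forms. -/
theorem isListed_iff {C : Set (Submodule k (T₂ k V))} {d : ℕ} :
    msa.IsListed k V C d ↔ ∃ s t, IsMaximalPair k s t ∧ C = kernels (pairForms k s t) ∧
      Module.finrank k (pairForms k s t) = d + 1 := by
  constructor
  · rintro (⟨s, t, hne, hst, hts⟩ | ⟨s, t, hne, hst⟩ | ⟨s, hs⟩)
    · refine ⟨s, t, ⟨pairForms_ne_bot hne, Or.inr hts⟩, (kernels_pairForms_of_isEmpty hne).symm, ?_⟩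
      rw [finrank_pairForms hne, Nat.card_of_isEmpty]
    · exact ⟨s, t, ⟨pairForms_ne_bot hne, Or.inl hst⟩, (kernels_pairForms hne).symm,
        finrank_pairForms hne⟩
    · refine ⟨s, s, ⟨pairForms_self_ne_bot_iff.2 hs, Or.inl hs⟩, (kernels_pairForms_self s).symm, ?_⟩
      rw [finrank_pairForms_self, Nat.sub_add_cancel Nat.card_pos]
  · rintro ⟨s, t, h, rfl, hd⟩
    by_cases hst : s = t
    · subst hst
      have hs := pairForms_self_ne_bot_iff.1 h.1
      rw [finrank_pairForms_self] at hd
      rw [kernels_pairForms_self, show d = Nat.card (s ⟶ s) - 1 by lia]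
      exact .loop s hs
    · rw [finrank_pairForms hst] at hd
      obtain rfl : Nat.card (s ⟶ t) = d := by lia
      rcases isEmpty_or_nonempty (s ⟶ t) with he | hne
      · rw [kernels_pairForms_of_isEmpty hst, Nat.card_of_isEmpty]
        exact .isolated s t hst he (h.2.resolve_left (not_nonempty_iff.2 he))
      · rw [kernels_pairForms hst]
        exact .nonloop s t hst hne

end T₂

/-! ### The variety as a finite union of linear subspaces, its components, dimension and embedding
-/

namespace msa

open T₂

variable {k V : Type*} [Field k] [Quiver V] [Fintype V] [Nonempty V]
  [∀ s t : V, Finite (s ⟶ t)]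

variable (k V) in
/-- The line of the linear forms which vanish on a hyperplane of `T₂Q`. -/
def formEquiv :
    Gr k (Module.finrank k (T₂ k V) - 1) (T₂ k V) ≃ ProjSpace k (Module.Dual k (T₂ k V)) :=
  Gr.hyperplaneEquiv finrank_eq_succ

theorem isMorphism_formEquiv : IsMorphism k (formEquiv k V) :=
  Gr.isMorphism_hyperplaneEquiv _

theorem isMorphism_formEquiv_symm : IsMorphism k (formEquiv k V).symm :=
  Gr.isMorphism_hyperplaneEquiv_symm _

/-- Combines `exists_mem_pairForms` with its converse, the twisted Leibniz rule. -/
theorem mem_iff {A : Gr k (Module.finrank k (T₂ k V) - 1) (T₂ k V)} :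
    A ∈ msa k V ↔ ∃ s t, formEquiv k V A ∈ linearSubspace (pairForms k s t) := by
  obtain ⟨F, hF⟩ := ProjSpace.ofFrame_surjective (formEquiv k V A)
  have hA := Gr.toSubmodule_eq_ker _ hF.symm
  simp only [← hF, ProjSpace.ofFrame_mem_linearSubspace]
  constructor
  · rintro ⟨S, hS⟩
    rw [hA] at hS
    have hmem : ∀ x, x ∈ S ↔ F.vec x = 0 := fun x => by
      rw [← Subalgebra.mem_toSubmodule, hS, LinearMap.mem_ker]
    refine exists_mem_pairForms F.vec_ne_zero ((hmem 1).1 S.one_mem) fun x y hx hy => ?_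
    exact (hmem _).1 (S.mul_mem ((hmem x).2 hx) ((hmem y).2 hy))
  · rintro ⟨s, t, h⟩
    have h1 : (1 : T₂ k V) ∈ LinearMap.ker F.vec := LinearMap.mem_ker.2 (mem_pairForms.1 h).1
    have hmul : ∀ x y, x ∈ LinearMap.ker F.vec → y ∈ LinearMap.ker F.vec →
        x * y ∈ LinearMap.ker F.vec := fun x y hx hy => by
      rw [LinearMap.mem_ker] at hx hy ⊢
      rw [pairForms_mul h, hx, hy, mul_zero, zero_mul, add_zero]
    exact ⟨(LinearMap.ker F.vec).toSubalgebra h1 hmul,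
      (Submodule.toSubalgebra_toSubmodule _ h1 hmul).trans hA.symm⟩

variable (k) in
/-- The subalgebras which are kernels of forms attached to a pair of vertices. -/
def pairSet (s t : V) : Set (msa k V) :=
  {A | formEquiv k V A.1 ∈ linearSubspace (pairForms k s t)}

theorem mem_pairSet {s t : V} {A : msa k V} :
    A ∈ pairSet k s t ↔ formEquiv k V A.1 ∈ linearSubspace (pairForms k s t) := Iff.rfl

theorem iUnion_pairSet : ⋃ p : V × V, pairSet k p.1 p.2 = Set.univ := by
  refine Set.eq_univ_of_forall fun A => ?_
  obtain ⟨s, t, h⟩ := mem_iff.1 A.2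
  exact Set.mem_iUnion.2 ⟨(s, t), h⟩

theorem isClosed_pairSet (s t : V) : IsClosed (pairSet k s t) :=
  (ProjSpace.isClosed_linearSubspace _).preimage
    (isMorphism_formEquiv.continuous.comp continuous_subtype_val)

theorem pairSet_subset_iff {s t s' t' : V} :
    pairSet k s t ⊆ pairSet k s' t' ↔ pairForms k s t ≤ pairForms k s' t' := by
  rw [← ProjSpace.linearSubspace_subset_iff]
  refine ⟨fun h x hx => ?_, fun h A hA => mem_pairSet.2 (h (mem_pairSet.1 hA))⟩
  have hA : (formEquiv k V).symm x ∈ msa k V :=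
    mem_iff.2 ⟨s, t, by rwa [Equiv.apply_symm_apply]⟩
  have h1 : (⟨_, hA⟩ : msa k V) ∈ pairSet k s t := by
    rwa [mem_pairSet, Equiv.apply_symm_apply]
  have h2 := mem_pairSet.1 (h h1)
  rwa [Equiv.apply_symm_apply] at h2

theorem subspaces_pairSet (s t : V) :
    subspaces (pairSet k s t) = kernels (pairForms k s t) := by
  ext A
  constructor
  · rintro ⟨A, hA, rfl⟩
    obtain ⟨F, hF⟩ := ProjSpace.ofFrame_surjective (formEquiv k V A.1)
    rw [mem_pairSet, ← hF, ProjSpace.ofFrame_mem_linearSubspace] at hA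
    exact ⟨F.vec, hA, F.vec_ne_zero, Gr.toSubmodule_eq_ker finrank_eq_succ hF.symm⟩
  · rintro ⟨f, hf, hf0, rfl⟩
    let x : ProjSpace k (Module.Dual k (T₂ k V)) := Gr.ofFrame (Frame.ofVec f hf0)
    have hx : x ∈ linearSubspace (pairForms k s t) :=
      ProjSpace.ofFrame_mem_linearSubspace.2 hf
    have hA : (formEquiv k V).symm x ∈ msa k V :=
      mem_iff.2 ⟨s, t, by rwa [Equiv.apply_symm_apply]⟩
    refine ⟨⟨_, hA⟩, ?_, ?_⟩
    · rwa [mem_pairSet, Equiv.apply_symm_apply]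
    · exact Gr.toSubmodule_eq_ker finrank_eq_succ (F := Frame.ofVec f hf0)
        ((formEquiv k V).apply_symm_apply x)

theorem isomorphic_pairSet_linearSubspace (s t : V) :
    Isomorphic k (pairSet k s t) (linearSubspace (pairForms k s t)) := by
  have h1 : ∀ x, x ∈ linearSubspace (pairForms k s t) → (formEquiv k V).symm x ∈ msa k V :=
    fun x hx => mem_iff.2 ⟨s, t, by rwa [Equiv.apply_symm_apply]⟩
  have h2 : ∀ x (hx : x ∈ linearSubspace (pairForms k s t)),
      (⟨_, h1 x hx⟩ : msa k V) ∈ pairSet k s t := fun x hx => by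
    rwa [mem_pairSet, Equiv.apply_symm_apply]
  refine isomorphic_of_isMorphism
    ⟨fun A => ⟨formEquiv k V A.1.1, A.2⟩, fun x => ⟨⟨_, h1 x.1 x.2⟩, h2 x.1 x.2⟩,
      fun A => Subtype.ext (Subtype.ext (by simp)), fun x => Subtype.ext (by simp)⟩ ?_ ?_
  · exact ((isMorphism_formEquiv.comp (isMorphism_subtype_val _)).comp
      (isMorphism_subtype_val _)).codRestrict fun A => A.2
  · exact ((isMorphism_formEquiv_symm.comp (isMorphism_subtype_val _)).codRestrict
      fun x => h1 x.1 x.2).codRestrict fun x => h2 x.1 x.2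

theorem isomorphic_pairSet {s t : V} {d : ℕ}
    (hd : Module.finrank k (pairForms k s t) = d + 1) :
    Isomorphic k (pairSet k s t) (ProjSpace k (Fin (d + 1) → k)) :=
  (isomorphic_pairSet_linearSubspace s t).trans (ProjSpace.isomorphic_of_finrank_eq hd)

theorem topologicalKrullDim_pairSet [Infinite k] {s t : V} {d : ℕ}
    (hd : Module.finrank k (pairForms k s t) = d + 1) :
    topologicalKrullDim (pairSet k s t) = d := by
  obtain ⟨φ, -⟩ := isomorphic_pairSet hd
  rw [φ.isHomeomorph.topologicalKrullDim_eq, ProjSpace.topologicalKrullDim_eq]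

theorem isIrreducible_pairSet [Infinite k] {s t : V} (h : pairForms k s t ≠ ⊥) :
    IsIrreducible (pairSet k s t) := by
  have h1 : Module.finrank k (pairForms k s t) ≠ 0 := Submodule.finrank_eq_zero.not.2 h
  obtain ⟨d, hd⟩ := Nat.exists_eq_succ_of_ne_zero h1
  obtain ⟨φ, -⟩ := isomorphic_pairSet hd
  have := φ.irreducibleSpace_iff.2 ProjSpace.irreducibleSpace
  exact IsIrreducible.of_subtype

theorem pairForms_ne_bot_of_nonempty {s t : V} (h : (pairSet k s t).Nonempty) :
    pairForms k s t ≠ ⊥ := by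
  obtain ⟨A, hA⟩ := h
  exact ProjSpace.linearSubspace_nonempty_iff.1 ⟨_, hA⟩

theorem exists_subset_pairSet {Z : Set (msa k V)} (hZ : IsIrreducible Z) :
    ∃ s t, Z ⊆ pairSet k s t := by
  obtain ⟨⟨s, t⟩, h⟩ := hZ.exists_subset_of_subset_iUnion
    (Z := fun p : V × V => pairSet k p.1 p.2) (fun p => isClosed_pairSet p.1 p.2)
    (by rw [iUnion_pairSet]; exact Set.subset_univ _)
  exact ⟨s, t, h⟩

/-- An irreducible set lies in one piece of the finite closed cover by the sets `pairSet`; the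
nonempty pieces are irreducible, so the components are the maximal ones among them. -/
theorem mem_irreducibleComponents_iff [Infinite k] {Z : Set (msa k V)} :
    Z ∈ irreducibleComponents (msa k V) ↔ ∃ s t, IsMaximalPair k s t ∧ Z = pairSet k s t := by
  constructor
  · intro hZ
    obtain ⟨s', t', h⟩ := exists_subset_pairSet hZ.1
    obtain ⟨s, t, hst, hle⟩ :=
      exists_isMaximalPair (pairForms_ne_bot_of_nonempty (hZ.1.nonempty.mono h))
    have h1 : Z ⊆ pairSet k s t := h.trans (pairSet_subset_iff.2 hle)
    exact ⟨s, t, hst, h1.antisymm (hZ.2 (isIrreducible_pairSet hst.1) h1)⟩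
  · rintro ⟨s, t, hst, rfl⟩
    refine ⟨isIrreducible_pairSet hst.1, fun Y hY hle => ?_⟩
    obtain ⟨s', t', h⟩ := exists_subset_pairSet hY
    exact h.trans (pairSet_subset_iff.2 (hst.pairForms_le (pairSet_subset_iff.1 (hle.trans h))))

theorem topologicalKrullDim_eq [Infinite k] :
    topologicalKrullDim (msa k V) =
      ⨆ d ∈ {d : ℕ | ∃ C, msa.IsListed k V C d}, ((d : ℕ∞) : WithBot ℕ∞) := by
  refine le_antisymm (topologicalKrullDim_le_of_irreducibleComponents fun Z hZ => ?_)
    (iSup₂_le fun d hd => ?_)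
  · obtain ⟨s, t, hst, rfl⟩ := mem_irreducibleComponents_iff.1 hZ
    obtain ⟨d, hd⟩ := Nat.exists_eq_succ_of_ne_zero (Submodule.finrank_eq_zero.not.2 hst.1)
    rw [topologicalKrullDim_pairSet hd]
    exact le_iSup₂_of_le (f := fun (d : ℕ) (_ : d ∈ {d : ℕ | ∃ C, msa.IsListed k V C d}) =>
      ((d : ℕ∞) : WithBot ℕ∞)) d ⟨_, isListed_iff.2 ⟨s, t, hst, rfl, hd⟩⟩ le_rfl
  · obtain ⟨C, hC⟩ := hd
    obtain ⟨s, t, -, -, hd⟩ := isListed_iff.1 hC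
    exact (topologicalKrullDim_pairSet hd).ge.trans (topologicalKrullDim_subspace_le _ _)

/-- All forms involved vanish at 1, so msa(Q) lies in the projective space of the hyperplane `K` of
the dual, and coordinates on `K` give the embedding. -/
theorem exists_isClosedEmbedding {N : ℕ} (hN : Module.finrank k (T₂ k V) = N + 1) :
    ∃ ι : msa k V → ProjSpace k (Fin N → k), IsClosedEmbedding k ι ∧
      ∀ s t : V, ∃ L : Submodule k (Fin N → k), ι '' pairSet k s t = linearSubspace L := by
  let K : Submodule k (Module.Dual k (T₂ k V)) :=
    LinearMap.ker (Module.Dual.eval k (T₂ k V) 1)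
  have hpK : ∀ s t : V, pairForms k s t ≤ K := fun s t f hf => hf.1
  have hK : Module.finrank k K = N := by
    obtain ⟨v⟩ := ‹Nonempty V›
    have h1 : Module.Dual.eval k (T₂ k V) 1 ≠ 0 := fun h =>
      one_ne_zero ((vertexCoeff_one v).symm.trans (LinearMap.congr_fun h (vertexCoeff k v)))
    have h2 := (Module.Dual.eval k (T₂ k V) 1).finrank_range_add_finrank_ker
    rw [LinearMap.range_eq_top.2 (LinearMap.surjective h1), finrank_top, Module.finrank_self,
      Subspace.dual_finrank_eq, hN] at h2
    exact Nat.add_left_cancel (h2.trans (Nat.add_comm N 1))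
  have : Module.Free k K := Module.Free.of_divisionRing k K
  let e : (Fin N → k) ≃ₗ[k] K := LinearEquiv.ofFinrankEq _ _ (by simp [hK])
  let j : (Fin N → k) →ₗ[k] Module.Dual k (T₂ k V) := K.subtype ∘ₗ e.toLinearMap
  have hj : LinearMap.ker j = ⊥ := LinearMap.ker_eq_bot.2 (Subtype.val_injective.comp e.injective)
  have hr : LinearMap.range j = K := by
    rw [LinearMap.range_comp, LinearEquiv.range, Submodule.map_top, Submodule.range_subtype]
  obtain ⟨ρ, hρ, hρj⟩ := ProjSpace.exists_retraction j hj
  have hmem : ∀ A : msa k V, formEquiv k V A.1 ∈ linearSubspace (LinearMap.range j) := fun A => by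
    obtain ⟨s, t, h⟩ := mem_iff.1 A.2
    rw [hr]
    exact le_trans h (hpK s t)
  let ι : msa k V → ProjSpace k (Fin N → k) := fun A => ρ ⟨formEquiv k V A.1, hmem A⟩
  have hι : IsMorphism k ι :=
    hρ.comp ((isMorphism_formEquiv.comp (isMorphism_subtype_val _)).codRestrict hmem)
  have hjι : ∀ A, ProjSpace.map j hj (ι A) = formEquiv k V A.1 := fun A => hρj _
  have himage : ∀ s t : V,
      ι '' pairSet k s t = linearSubspace ((pairForms k s t).comap j) := by
    intro s t
    ext x
    have hx : x ∈ linearSubspace ((pairForms k s t).comap j) ↔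
        ProjSpace.map j hj x ∈ linearSubspace (pairForms k s t) :=
      Submodule.map_le_iff_le_comap.symm
    rw [hx]
    constructor
    · rintro ⟨A, hA, rfl⟩
      rw [hjι]
      exact hA
    · intro h
      have hA : (formEquiv k V).symm (ProjSpace.map j hj x) ∈ msa k V :=
        mem_iff.2 ⟨s, t, by rwa [Equiv.apply_symm_apply]⟩
      refine ⟨⟨_, hA⟩, ?_, ProjSpace.map_injective j hj ?_⟩
      · rwa [mem_pairSet, Equiv.apply_symm_apply]
      · rw [hjι, Equiv.apply_symm_apply]
  -- The range is the finite union of the images of the pieces, each a linear subspace.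
  have hclosed : IsClosed (Set.range ι) := by
    rw [← Set.image_univ, ← iUnion_pairSet, Set.image_iUnion]
    refine isClosed_iUnion_of_finite fun p => ?_
    rw [himage]
    exact ProjSpace.isClosed_linearSubspace _
  have hback : ∀ x ∈ Set.range ι, (formEquiv k V).symm (ProjSpace.map j hj x) ∈ msa k V := by
    rintro _ ⟨A, rfl⟩
    rw [hjι, Equiv.symm_apply_apply]
    exact A.2
  refine ⟨ι, isClosedEmbedding_of_isMorphism hι hclosed (fun x => ⟨_, hback x.1 x.2⟩)
    (((isMorphism_formEquiv_symm.comp (ProjSpace.isMorphism_map j hj)).comp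
      (isMorphism_subtype_val _)).codRestrict fun x => hback x.1 x.2) fun A => ?_,
    fun s t => ⟨_, himage s t⟩⟩
  exact Subtype.ext (by simp [hjι])

theorem irreducibleSpace_iff [Infinite k] :
    IrreducibleSpace (msa k V) ↔
      ∃ s t : V, pairForms k s t ≠ ⊥ ∧ ∀ u w : V, pairForms k u w ≤ pairForms k s t := by
  rw [irreducibleSpace_def]
  constructor
  · intro h
    obtain ⟨s, t, hst⟩ := exists_subset_pairSet h
    exact ⟨s, t, pairForms_ne_bot_of_nonempty (h.nonempty.mono hst), fun u w =>
      pairSet_subset_iff.1 ((Set.subset_univ _).trans hst)⟩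
  · rintro ⟨s, t, h0, h⟩
    have : (⊤ : Set (msa k V)) = pairSet k s t := by
      refine (Set.eq_univ_of_univ_subset ?_).symm
      rw [← iUnion_pairSet]
      exact Set.iUnion_subset fun p => pairSet_subset_iff.2 (h p.1 p.2)
    rw [this]
    exact isIrreducible_pairSet h0

end msa

/-! ### The quivers for which one space of forms contains all the others -/

namespace T₂

variable {k V : Type*} [Field k] [Quiver V] [Fintype V] [∀ s t : V, Finite (s ⟶ t)]

theorem exists_forall_pairForms_le_iff :
    (∃ s t : V, pairForms k s t ≠ ⊥ ∧ ∀ u w : V, pairForms k u w ≤ pairForms k s t) ↔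
      (∃ m : ℕ, 1 ≤ m ∧ IsKroneckerQuiver V m) ∨ (∃ m : ℕ, 1 ≤ m ∧ IsLoopQuiver V m) ∨
        IsTwoIsolatedVertices V := by
  constructor
  · rintro ⟨s, t, h0, h⟩
    -- Containment of all spaces in L(s,t) forces every arrow to run from `s` to `t`; the forms χ_u
    -- - χ_w then force every vertex to be `s` or `t`.
    have harrow : ∀ u w : V, (u ⟶ w) → u = s ∧ w = t := fun u w α =>
      eq_of_pairForms_le_of_hom α (h u w)
    by_cases hst : s = t
    · subst hst
      refine Or.inr (Or.inl ⟨Nat.card (s ⟶ s), ?_, s, fun v => ?_, rfl⟩)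
      · have := pairForms_self_ne_bot_iff.1 h0
        exact Nat.card_pos
      · by_contra hv
        have h1 := (mem_pair_of_pairForms_le hv (h v s)).1
        exact hv (h1.elim id id)
    · have hV : ∀ v, v = s ∨ v = t := fun v => by
        by_cases hv : v = s
        · exact Or.inl hv
        · exact (mem_pair_of_pairForms_le hv (h v s)).1
      rcases isEmpty_or_nonempty (s ⟶ t) with he | hne
      · refine Or.inr (Or.inr ⟨Nat.card_eq_two_iff.2 ⟨s, t, hst, ?_⟩, fun u w => ⟨fun α => ?_⟩⟩)
        · exact Set.eq_univ_of_forall hV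
        · obtain ⟨rfl, rfl⟩ := harrow u w α
          exact isEmptyElim α
      · refine Or.inl ⟨Nat.card (s ⟶ t), Nat.card_pos, s, t, hst, hV, rfl, ⟨fun α => ?_⟩,
          ⟨fun α => ?_⟩, ⟨fun α => ?_⟩⟩
        · exact hst (harrow _ _ α).2
        · exact hst (harrow _ _ α).1.symm
        · exact hst (harrow _ _ α).2
  · rintro (⟨m, -, s, t, hst, hV, -, hss, htt, hts⟩ | ⟨m, hm, s, hV, hs⟩ | ⟨hV, hQ⟩)
    · refine ⟨s, t, pairForms_ne_bot hst, pairForms_le_of_forall hV fun u w α => ?_⟩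
      obtain rfl | rfl := hV u <;> obtain rfl | rfl := hV w
      · exact isEmptyElim α
      · exact ⟨rfl, rfl⟩
      · exact isEmptyElim α
      · exact isEmptyElim α
    · have hne : Nonempty (s ⟶ s) := by
        rw [← not_isEmpty_iff]
        intro he
        rw [Nat.card_of_isEmpty] at hs
        lia
      exact ⟨s, s, pairForms_self_ne_bot_iff.2 hne, pairForms_le_of_forall (fun v => Or.inl (hV v))
        fun u w _ => ⟨hV u, hV w⟩⟩
    · obtain ⟨s, t, hst, h⟩ := Nat.card_eq_two_iff.1 hV
      refine ⟨s, t, pairForms_ne_bot hst, pairForms_le_of_forall (fun v => ?_) fun u w α =>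
        ((hQ u w).false α).elim⟩
      have : v ∈ ({s, t} : Set V) := h ▸ Set.mem_univ v
      exact this

end T₂

end

/-! ### The main theorem -/

theorem corollaryc (k V : Type*) [Field k] [IsAlgClosed k] [Quiver V] [Fintype V] [Nonempty V]
    [∀ s t : V, Finite (s ⟶ t)] :
    -- the sets on the list are irreducible components, of the given dimensions, and
    -- they are projective spaces
    (∀ (C : Set (Submodule k (T₂ k V))) (d : ℕ), msa.IsListed k V C d →
      ∃ Z ∈ irreducibleComponents (msa k V), msa.subspaces Z = C ∧
        topologicalKrullDim Z = d ∧
        SpaceWithFunctions.Isomorphic k Z (ProjSpace k (Fin (d + 1) → k))) ∧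
    -- every irreducible component is on the list
    (∀ Z ∈ irreducibleComponents (msa k V), ∃ d : ℕ, msa.IsListed k V (msa.subspaces Z) d) ∧
    -- in one closed embedding into projective space of dimension `|Q₀| + |Q₁| - 2`, all
    -- irreducible components are linear subspaces
    (∃ ι : msa k V → ProjSpace k (Fin (Nat.card V + Nat.card (Σ s t : V, s ⟶ t) - 1) → k),
      SpaceWithFunctions.IsClosedEmbedding k ι ∧
      ∀ Z ∈ irreducibleComponents (msa k V),
        ∃ L : Submodule k (Fin (Nat.card V + Nat.card (Σ s t : V, s ⟶ t) - 1) → k),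
          ι '' Z = linearSubspace L) ∧
    -- the dimension is the maximum of the dimensions of the components
    topologicalKrullDim (msa k V) =
      ⨆ d ∈ {d : ℕ | ∃ C, msa.IsListed k V C d}, ((d : ℕ∞) : WithBot ℕ∞) ∧
    -- the irreducible case
    (IrreducibleSpace (msa k V) ↔
      (∃ m : ℕ, 1 ≤ m ∧ IsKroneckerQuiver V m) ∨ (∃ m : ℕ, 1 ≤ m ∧ IsLoopQuiver V m) ∨
        IsTwoIsolatedVertices V) := by
  have hN : Module.finrank k (T₂ k V) =
      Nat.card V + Nat.card (Σ s t : V, s ⟶ t) - 1 + 1 := by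
    have h1 : 0 < Nat.card V := Nat.card_pos
    rw [T₂.finrank_eq]
    lia
  have : Infinite k := IsAlgClosed.instInfinite
  refine ⟨fun C d hC => ?_, fun Z hZ => ?_, ?_, msa.topologicalKrullDim_eq,
    msa.irreducibleSpace_iff.trans T₂.exists_forall_pairForms_le_iff⟩
  · obtain ⟨s, t, hst, rfl, hd⟩ := T₂.isListed_iff.1 hC
    exact ⟨msa.pairSet k s t, msa.mem_irreducibleComponents_iff.2 ⟨s, t, hst, rfl⟩,
      msa.subspaces_pairSet s t, msa.topologicalKrullDim_pairSet hd, msa.isomorphic_pairSet hd⟩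
  · obtain ⟨s, t, hst, rfl⟩ := msa.mem_irreducibleComponents_iff.1 hZ
    obtain ⟨d, hd⟩ := Nat.exists_eq_succ_of_ne_zero (Submodule.finrank_eq_zero.not.2 hst.1)
    exact ⟨d, T₂.isListed_iff.2 ⟨s, t, hst, msa.subspaces_pairSet s t, hd⟩⟩
  · obtain ⟨ι, hι, h⟩ := msa.exists_isClosedEmbedding hN
    refine ⟨ι, hι, fun Z hZ => ?_⟩
    obtain ⟨s, t, -, rfl⟩ := msa.mem_irreducibleComponents_iff.1 hZ
    exact h s t
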